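/- Let $D\ge 3$ and write $|1\rangle,\dots,|D\rangle$ for the computational basis of $\mathbb C^D$. A \emph{state} is a positive semidefinite $D\times D$ matrix of trace $1$; a \emph{pure state} is a rank-one orthogonal projector. For a normalized vector $|\omega\rangle$ let $\omega$ denote the projector $|\omega\rangle\langle\omega|$, and let $\|\cdot\|_1$ be the trace norm. Let $\mathcal T$ consist of the pure states given by $$|Z_k\rangle=|k\rangle\ (1\le k\le D),\qquad |X_k\rangle=\tfrac{1}{\sqrt2}(|k\rangle+|k+1\rangle),\quad |Y_k\rangle=\tfrac1{\sqrt2}(|k\rangle+i|k+1\rangle)\ (1\le k\le D-1),$$ $$|XX_k\rangle=\tfrac1{\sqrt3}(|k\rangle+|k+1\rangle+|k+2\rangle),\quad |YY_k\rangle=\tfrac1{\sqrt3}(i|k\rangle+|k+1\rangle+i|k+2\rangle)\ (1\le k\le D-2).$$ \textbf{(a)} Let $\Phi=\{\psi_j\}_{j=1}^M\cup\mathcal T$, where the $\psi_j$ are pure states and $f_j>0$ are real numbers with $\operatorname{tr}(\psi_jZ_k)>1/f_j$ for all $j,k$. For each $\alpha\in\Phi$ (labelled by its symbol) let $\alpha^{(0)}$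 be a state, pure or mixed, and suppose that $$|\operatorname{tr}(\alpha^{(0)}\beta^{(0)})-\operatorname{tr}(\alpha\beta)|\le\delta_o\quad\forall\,\alpha,\beta\in\Phi,\ \alpha\ne\beta,\qquad 1-\operatorname{tr}\big((\alpha^{(0)})^2\big)\le\delta_p\quad\forall\,\alpha\in\Phi .$$ Put $f(\mu,\nu)=\frac12\big(\nu+\sqrt{\nu^2-4\mu}\big)$, $\ \xi(D,F)=\big(1-\frac{D-1}{F}\big)^{-1}\big(1-\cos\frac{\pi}{D}\big)$ and $$\delta_Z'=2\delta_p+\delta_o,\qquad \delta_Z=2\delta_p+2\sqrt{1-\Big(1-\tfrac{\delta_Z'}{8}(D-1)^2\Big)^2},$$ $$\delta_X'=\tfrac{\delta_Z}{2}+\delta_p+\delta_o,\qquad \delta_X=2\sqrt2\sqrt{\delta_X'}+2\delta_p,$$ $$\mu_Y=\Big[\tfrac{\delta_X+\delta_Z}{2}+2\delta_p+2\delta_o\Big]^2+\Big[\tfrac{\delta_Z}2+\delta_p+\delta_o\Big]^2,\quad \nu_Y=1-2\Big[\tfrac{\delta_Z}2+\delta_p+\delta_o\Big],\quad \delta_Y=2\delta_p+2\sqrt{1-f(\mu_Y,\nu_Y)},$$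 $$\delta_{XX}=2\sqrt{\tfrac65\delta_X+\tfrac9{10}\delta_Z+\tfrac{21}5\delta_o},\qquad \delta_{YY}=2\sqrt{\tfrac32\delta_Z+2\delta_Y+7\delta_o},$$ and let $\delta_j^\psi\ge 0$ be given by $$\frac{(\delta^\psi_j)^2}{4}=\Big(D+\tfrac{(D-1)(1+\sqrt2)f_j}{2\xi(D,f_j)}\Big)\delta_Z+\tfrac{f_j(D-1)}{2\xi(D,f_j)}(\delta_X+\delta_Y)+\Big(D+\tfrac{(D-1)(1+\sqrt2)f_j}{\xi(D,f_j)}+\tfrac{2f_j(D-1)}{\xi(D,f_j)}\Big)\delta_o .$$ Suppose further that $$\delta_Z'<\frac1{(D-1)^2},\qquad \nu_Y^2-4\mu_Y\ge0,\qquad -0.2938+0.7970\,\delta_Y+2.2555\,\delta_Z+0.5\,\delta_{XX}+7.1049\,\delta_o<0 .$$ Then there is a single unitary or anti-unitary $U$ such that $\|UZ_k^{(0)}U^\dagger-Z_k\|_1\le\delta_Z$ for $1\le k\le D$; $\|UX_k^{(0)}U^\dagger-X_k\|_1\le\delta_X$ and $\|UY_k^{(0)}U^\dagger-Y_k\|_1\le\delta_Y$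 for $1\le k\le D-1$; $\|UXX_k^{(0)}U^\dagger-XX_k\|_1\le\delta_{XX}$ and $\|UYY_k^{(0)}U^\dagger-YY_k\|_1\le\delta_{YY}$ for $1\le k\le D-2$; and $\|U\psi_j^{(0)}U^\dagger-\psi_j\|_1\le\delta_j^\psi$ for $1\le j\le M$. \textbf{(b)} Consequently $\Phi$ has the robust Wigner property with $\delta'=O(\sqrt f\,D^{7/4}\delta^{1/8})$: there is an absolute constant $C>0$ such that, for all $D\ge3$, $M\ge1$, $f>0$, all pure states $\psi_1,\dots,\psi_M$ with $\operatorname{tr}(\psi_jZ_k)\ge 1/f$ for all $j,k$, all $\delta\ge0$ and all states $\{\alpha^{(0)}\}_{\alpha\in\Phi}$ with $|\operatorname{tr}(\alpha^{(0)}\beta^{(0)})-\operatorname{tr}(\alpha\beta)|\le\delta$ for all $\alpha,\beta\in\Phi$ (including $\alpha=\beta$), there is a unitary or anti-unitary $U$ with $\|\alpha-U\alpha^{(0)}U^\dagger\|_1\le C\sqrt f\,D^{7/4}\delta^{1/8}$ for all $\alpha\in\Phi$. -/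

import Mathlib

open Matrix
open scoped ComplexOrder

noncomputable section

namespace RobustWigner

/-- The operators on `ℂ^D`, written in the computational basis. -/
abbrev Op (D : ℕ) : Type := Matrix (Fin D) (Fin D) ℂ

/-- A (possibly mixed) quantum state: a positive semidefinite operator of trace one. -/
def IsState {D : ℕ} (ρ : Op D) : Prop := ρ.PosSemidef ∧ ρ.trace = 1

/-- The operator `|v⟩⟨v|`. -/
def proj {D : ℕ} (v : Fin D → ℂ) : Op D := vecMulVec v (star v)

/-- A pure state: the rank-one projector onto a normalized vector. -/
def IsPureState {D : ℕ} (ρ : Op D) : Prop :=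
  ∃ v : Fin D → ℂ, ∑ i, ‖v i‖ ^ 2 = 1 ∧ ρ = proj v

/-- The overlap `tr (A B)`; it is a real number for Hermitian `A`, `B`. -/
def overlap {D : ℕ} (A B : Op D) : ℝ := (A * B).trace.re

/-- The trace norm `‖A‖₁ = tr √(A† A)`: the sum of the singular values of `A`. -/
def traceNorm {D : ℕ} (A : Op D) : ℝ :=
  ∑ i, √((isHermitian_conjTranspose_mul_self A).eigenvalues i)

/-- `T` is the map `ρ ↦ U ρ U†` for a unitary or an anti-unitary `U`.
An anti-unitary is `U = V K` with `V` unitary and `K` the complex conjugation in the computational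
basis, so that `U ρ U† = V (K ρ K) V†`, and `K ρ K` is the entrywise complex conjugate of `ρ`. -/
def IsUnitaryOrAntiunitaryConj {D : ℕ} (T : Op D → Op D) : Prop :=
  (∃ V ∈ unitaryGroup (Fin D) ℂ, ∀ ρ, T ρ = V * ρ * Vᴴ) ∨
  (∃ V ∈ unitaryGroup (Fin D) ℂ, ∀ ρ, T ρ = V * ρ.map (starRingEnd ℂ) * Vᴴ)

/-- The computational basis vector `|n⟩`, with `n = 0, …, D - 1`. -/
def ket (D n : ℕ) : Fin D → ℂ := fun i => if (i : ℕ) = n then 1 else 0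

/-- The symbols of the ensemble `{ψ_j} ∪ 𝒯`. All indices start from zero. -/
inductive Label (M D : ℕ) : Type
  | psi (j : Fin M)
  | Z (k : Fin D)
  | X (k : Fin (D - 1))
  | Y (k : Fin (D - 1))
  | XX (k : Fin (D - 2))
  | YY (k : Fin (D - 2))

/-- The reference state that a symbol stands for. -/
def refState {M D : ℕ} (ψ : Fin M → Op D) : Label M D → Op D
  | .psi j => ψ j
  | .Z k => proj (ket D k)
  | .X k => proj (((1 / √2 : ℝ) : ℂ) • (ket D k + ket D (k + 1)))
  | .Y k => proj (((1 / √2 : ℝ) : ℂ) • (ket D k + Complex.I • ket D (k + 1)))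
  | .XX k => proj (((1 / √3 : ℝ) : ℂ) • (ket D k + ket D (k + 1) + ket D (k + 2)))
  | .YY k => proj (((1 / √3 : ℝ) : ℂ) •
      (Complex.I • ket D k + ket D (k + 1) + Complex.I • ket D (k + 2)))

/-- The family `Φ` of reference states satisfies the Wigner property with precision `δ' = g δ`:
any states whose overlaps agree with those of `Φ` up to `δ` are `g δ`-close to `Φ` in trace norm,
modulo a unitary or an anti-unitary transformation. -/
def WignerPropertyWith {ι : Type} {D : ℕ} (Φ : ι → Op D) (g : ℝ → ℝ) : Prop :=
  ∀ (δ : ℝ) (ρ : ι → Op D), 0 ≤ δ → (∀ a, IsState (ρ a)) →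
    (∀ a b, |overlap (Φ a) (Φ b) - overlap (ρ a) (ρ b)| ≤ δ) →
    ∃ T : Op D → Op D, IsUnitaryOrAntiunitaryConj T ∧ ∀ a, traceNorm (Φ a - T (ρ a)) ≤ g δ

/-! The error bounds, as functions of the dimension `D`, the purity defect `δp` and the overlap
error `δo`. -/

/-- `f(μ, ν) = (ν + √(ν² - 4 μ)) / 2`. -/
def fRoot (μ ν : ℝ) : ℝ := (1 / 2) * (ν + √(ν ^ 2 - 4 * μ))

/-- `ξ(D, F)`. -/
def xi (D : ℕ) (F : ℝ) : ℝ :=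
  (1 / (1 - ((D : ℝ) - 1) / F)) * (1 - Real.cos (Real.pi / D))

/-- `δ'_Z`. -/
def deltaZ' (δp δo : ℝ) : ℝ := 2 * δp + δo

/-- `δ_Z`. -/
def deltaZ (D : ℕ) (δp δo : ℝ) : ℝ :=
  2 * δp + 2 * √(1 - (1 - deltaZ' δp δo / 8 * ((D : ℝ) - 1) ^ 2) ^ 2)

/-- `δ'_X`. -/
def deltaX' (D : ℕ) (δp δo : ℝ) : ℝ := deltaZ D δp δo / 2 + δp + δo

/-- `δ_X`. -/
def deltaX (D : ℕ) (δp δo : ℝ) : ℝ := 2 * √2 * √(deltaX' D δp δo) + 2 * δp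

/-- The first argument of `f` in `δ_Y`. -/
def muY (D : ℕ) (δp δo : ℝ) : ℝ :=
  ((deltaX D δp δo + deltaZ D δp δo) / 2 + 2 * δp + 2 * δo) ^ 2
    + (deltaZ D δp δo / 2 + δp + δo) ^ 2

/-- The second argument of `f` in `δ_Y`. -/
def nuY (D : ℕ) (δp δo : ℝ) : ℝ := 1 - 2 * (deltaZ D δp δo / 2 + δp + δo)

/-- `δ_Y`. -/
def deltaY (D : ℕ) (δp δo : ℝ) : ℝ :=
  2 * δp + 2 * √(1 - fRoot (muY D δp δo) (nuY D δp δo))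

/-- `δ_XX`. -/
def deltaXX (D : ℕ) (δp δo : ℝ) : ℝ :=
  2 * √(6 / 5 * deltaX D δp δo + 9 / 10 * deltaZ D δp δo + 21 / 5 * δo)

/-- `δ_YY`. -/
def deltaYY (D : ℕ) (δp δo : ℝ) : ℝ :=
  2 * √(3 / 2 * deltaZ D δp δo + 2 * deltaY D δp δo + 7 * δo)

/-- `δ^ψ`, for a reference state all of whose computational-basis weights exceed `1 / F`. -/
def deltaPsi (D : ℕ) (F δp δo : ℝ) : ℝ :=
  2 * √((D + ((D : ℝ) - 1) * (1 + √2) * F / (2 * xi D F)) * deltaZ D δp δo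
    + F * ((D : ℝ) - 1) / (2 * xi D F) * deltaX D δp δo
    + F * ((D : ℝ) - 1) / (2 * xi D F) * deltaY D δp δo
    + (D + ((D : ℝ) - 1) * (1 + √2) * F / xi D F + 2 * (F * ((D : ℝ) - 1) / xi D F)) * δo)

/-- The trace-norm error allowed for each element of the ensemble. -/
def errorBound {M D : ℕ} (f : Fin M → ℝ) (δp δo : ℝ) : Label M D → ℝ
  | .psi j => deltaPsi D (f j) δp δo
  | .Z _ => deltaZ D δp δo
  | .X _ => deltaX D δp δo
  | .Y _ => deltaY D δp δo
  | .XX _ => deltaXX D δp δo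
  | .YY _ => deltaYY D δp δo

end RobustWigner

end

open RobustWigner

/-!
# Robustness of Wigner's theorem for a finite ensemble of pure states

The transformation is assembled in three steps, each of which fixes a part of the freedom that is
left by the preceding one.

*Basis.* A state of purity at least `1 - δp` is within `2 δp` of the projector onto its leading
eigenvector (`exists_pure_approx`). The leading eigenvectors of the states that imitate `Z_k` are
almost orthonormal, and symmetric orthogonalization (`exists_unitary_of_almost_orthonormal`) yields
a unitary taking them close to the computational basis. *Phases.* The overlaps with the `Z_k` force
the states imitating `X_k` and `Y_k` to be almost equal superpositions of two neighbouring basis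
states. A diagonal unitary makes the coherences of the `X_k` positive
(`IsFramed.exists_xAligned`). *Complex conjugation.* The overlap of `Y_k` with `X_k` then determines
`Y_k` up to complex conjugation (`IsXAligned.exists_sign`). The overlap of `YY_k` with `XX_k`, which
is `5 / 9` but would be `1 / 9` for opposite orientations of the edges `k` and `k + 1`, makes the
orientation constant along the path (`IsXAligned.sign_eq`). Hence it is corrected by one global
complex conjugation.

The remaining states `XX_k`, `YY_k` and `ψ_j` are pinned by parent Hamiltonians: each is the unique
ground state of a gapped operator that is a real combination of the projectors `Z`, `X`, `Y`, so
small errors in these overlaps bound the infidelity, and the inequality of Fuchs and van de Graaf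
(`traceNorm_sub_proj_le`) turns it into trace distance. For `ψ_j` this operator is a path Laplacian
in rescaled amplitudes (`gap_vector`); its gap is the optimal constant `2 (1 - cos (π / D))` in the
discrete Poincaré inequality on the path (`poincare`).

The bound `deltaXX` has a smaller coefficient of `deltaX` than the parent Hamiltonian gives, and the
orientation argument needs accurate `Y_k`. For both, the total weight of the leading eigenvectors
of the states `X_k`, `Y_k` on their two levels is estimated to second order
(`IsFramed.two_level`), so that the true errors are linear in `deltaX'`, whereas `deltaX` is of
order `√deltaX'`.

The asymptotic claim follows by substituting `δ = y ^ 4 / D ^ 2` in the explicit bounds.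
-/

namespace RobustWigner

variable {D M : ℕ}

/-! ### Overlaps -/

lemma overlap_comm (A B : Op D) : overlap A B = overlap B A := by
  rw [overlap, overlap, trace_mul_comm]

lemma overlap_sub_left (A B C : Op D) : overlap (A - B) C = overlap A C - overlap B C := by
  simp [overlap, sub_mul]

lemma overlap_sub_right (A B C : Op D) : overlap A (B - C) = overlap A B - overlap A C := by
  simp [overlap, mul_sub]

lemma overlap_one_right (A : Op D) : overlap A 1 = A.trace.re := by
  simp [overlap]

lemma overlap_proj (A : Op D) (v : Fin D → ℂ) :
    overlap A (proj v) = (star v ⬝ᵥ (A *ᵥ v)).re := by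
  rw [overlap, proj, mul_vecMulVec, trace_vecMulVec, dotProduct_comm]

lemma proj_mulVec (v w : Fin D → ℂ) : proj v *ᵥ w = (star v ⬝ᵥ w) • v := by
  rw [proj, vecMulVec_mulVec]
  ext i; simp [mul_comm]

lemma overlap_proj_proj (u v : Fin D → ℂ) :
    overlap (proj u) (proj v) = ‖star u ⬝ᵥ v‖ ^ 2 := by
  rw [overlap_proj, proj_mulVec, dotProduct_smul, smul_eq_mul]
  have : star v ⬝ᵥ u = star (star u ⬝ᵥ v) := by
    rw [star_dotProduct]
  rw [this]
  simp [Complex.mul_conj, Complex.normSq_eq_norm_sq, - Complex.ofReal_pow]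

lemma star_dotProduct_self (v : Fin D → ℂ) :
    star v ⬝ᵥ v = ((∑ i, ‖v i‖ ^ 2 : ℝ) : ℂ) := by
  simp [dotProduct, Complex.conj_mul']

lemma posSemidef_proj (v : Fin D → ℂ) : (proj v).PosSemidef :=
  posSemidef_vecMulVec_self_star v

lemma trace_proj (v : Fin D → ℂ) : (proj v).trace = ((∑ i, ‖v i‖ ^ 2 : ℝ) : ℂ) := by
  rw [proj, trace_vecMulVec, dotProduct_comm, star_dotProduct_self]

lemma isState_proj {v : Fin D → ℂ} (hv : ∑ i, ‖v i‖ ^ 2 = 1) : IsState (proj v) :=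
  ⟨posSemidef_proj v, by rw [trace_proj, hv]; simp⟩

/-! ### The spectral decomposition and the trace norm -/

lemma exists_diagonalization {A : Op D} (hA : A.IsHermitian) :
    ∃ W : Op D, Wᴴ * W = 1 ∧ W * Wᴴ = 1 ∧ ∃ l : Fin D → ℝ,
      A = W * diagonal (fun i => (l i : ℂ)) * Wᴴ := by
  refine ⟨hA.eigenvectorUnitary, ?_, ?_, hA.eigenvalues, ?_⟩
  · exact Unitary.coe_star_mul_self hA.eigenvectorUnitary
  · exact Unitary.coe_mul_star_self hA.eigenvectorUnitary
  · exact hA.spectral_theorem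

lemma diagonalization_mul {W : Op D} (hW : Wᴴ * W = 1) (a b : Fin D → ℂ) :
    (W * diagonal a * Wᴴ) * (W * diagonal b * Wᴴ) = W * diagonal (fun i => a i * b i) * Wᴴ := by
  calc _ = W * diagonal a * (Wᴴ * W) * diagonal b * Wᴴ := by simp only [Matrix.mul_assoc]
    _ = _ := by rw [hW, Matrix.mul_one, Matrix.mul_assoc W, diagonal_mul_diagonal]

lemma diagonalization_conjTranspose (W : Op D) (a : Fin D → ℝ) :
    (W * diagonal (fun i => (a i : ℂ)) * Wᴴ)ᴴ = W * diagonal (fun i => (a i : ℂ)) * Wᴴ := by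
  simp only [conjTranspose_mul, conjTranspose_conjTranspose, diagonal_conjTranspose,
    Matrix.mul_assoc]
  congr 3
  ext i
  simp

open Polynomial in
lemma traceNorm_diagonalization {W : Op D} (hW : Wᴴ * W = 1) (l : Fin D → ℝ) :
    traceNorm (W * diagonal (fun i => (l i : ℂ)) * Wᴴ) = ∑ i, |l i| := by
  set A := W * diagonal (fun i => (l i : ℂ)) * Wᴴ with hAdef
  have hAA : Aᴴ * A = W * diagonal (fun i => ((l i ^ 2 : ℝ) : ℂ)) * Wᴴ := by
    rw [hAdef, diagonalization_conjTranspose, diagonalization_mul hW]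
    congr 3; ext i; push_cast; ring
  have hchar : (Aᴴ * A).charpoly = ∏ i, (X - C (((l i ^ 2 : ℝ) : ℂ))) := by
    rw [hAA, charpoly_mul_comm, ← Matrix.mul_assoc, hW, Matrix.one_mul, charpoly_diagonal]
  have hroots := (isHermitian_conjTranspose_mul_self A).roots_charpoly_eq_eigenvalues
  rw [hchar, Polynomial.roots_prod _ _ (Finset.prod_ne_zero_iff.2 fun i _ => X_sub_C_ne_zero _)]
    at hroots
  have hmap := congrArg (fun s : Multiset ℂ => (s.map (fun z => √ z.re)).sum) hroots
  simp only [roots_X_sub_C, Multiset.bind_singleton, Multiset.map_map] at hmap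
  simp only [Function.comp_def] at hmap
  rw [traceNorm]
  refine Eq.trans ?_ (hmap.symm.trans ?_)
  · simp [Finset.sum]
  · simp [Finset.sum, Real.sqrt_sq_eq_abs, - Complex.ofReal_pow]

lemma overlap_diagonalization (W Q : Op D) (l : Fin D → ℝ) :
    overlap (W * diagonal (fun i => (l i : ℂ)) * Wᴴ) Q = ∑ i, l i * ((Wᴴ * Q * W) i i).re := by
  rw [overlap, Matrix.mul_assoc, Matrix.mul_assoc, trace_mul_comm, Matrix.mul_assoc, trace,
    Complex.re_sum]
  simp [diagonal_mul, Matrix.mul_assoc]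

lemma trace_diagonalization {W : Op D} (hW : Wᴴ * W = 1) (a : Fin D → ℂ) :
    (W * diagonal a * Wᴴ).trace = ∑ i, a i := by
  rw [trace_mul_comm, ← Matrix.mul_assoc, hW, Matrix.one_mul, trace_diagonal]

/-- A traceless Hermitian operator has overlap at most `‖A‖₁ / 2` with every effect `0 ≤ Q ≤ 1`:
its positive and its negative part have the same trace. -/
lemma overlap_le_traceNorm_div_two {A Q : Op D} (hA : A.IsHermitian) (htr : A.trace = 0)
    (hQ : Q.PosSemidef) (hQ' : (1 - Q).PosSemidef) : overlap A Q ≤ traceNorm A / 2 := by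
  obtain ⟨W, hW, -, l, rfl⟩ := exists_diagonalization hA
  rw [traceNorm_diagonalization hW, overlap_diagonalization]
  rw [trace_diagonalization hW, ← Complex.ofReal_sum, Complex.ofReal_eq_zero] at htr
  have h0 : ∀ i, 0 ≤ ((Wᴴ * Q * W) i i).re := fun i =>
    (Complex.nonneg_iff.1 (hQ.conjTranspose_mul_mul_same W).diag_nonneg).1
  have h1 : ∀ i, ((Wᴴ * Q * W) i i).re ≤ 1 := fun i => by
    have := (Complex.nonneg_iff.1 ((hQ'.conjTranspose_mul_mul_same W).diag_nonneg (i := i))).1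
    rw [Matrix.mul_sub, Matrix.sub_mul, Matrix.mul_one, hW] at this
    simpa using this
  have : ∑ i, l i * ((Wᴴ * Q * W) i i).re ≤ ∑ i, (|l i| + l i) / 2 := by
    refine Finset.sum_le_sum fun i _ => ?_
    rcases abs_cases (l i) with ⟨h, h'⟩ | ⟨h, h'⟩ <;> rw [h] <;> nlinarith [h0 i, h1 i]
  rw [← Finset.sum_div, Finset.sum_add_distrib, htr, add_zero] at this
  exact this

/-- The bound of `overlap_le_traceNorm_div_two` is attained, at the projector onto the positive
part. -/
lemma exists_projector_traceNorm {A : Op D} (hA : A.IsHermitian) (htr : A.trace = 0) :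
    ∃ Q : Op D, Qᴴ = Q ∧ Q * Q = Q ∧ traceNorm A = 2 * overlap A Q := by
  obtain ⟨W, hW, -, l, rfl⟩ := exists_diagonalization hA
  rw [trace_diagonalization hW, ← Complex.ofReal_sum, Complex.ofReal_eq_zero] at htr
  set q : Fin D → ℝ := fun i => if 0 ≤ l i then 1 else 0 with hq
  refine ⟨W * diagonal (fun i => (q i : ℂ)) * Wᴴ, diagonalization_conjTranspose W q, ?_, ?_⟩
  · rw [diagonalization_mul hW]
    congr 3; ext i; by_cases h : 0 ≤ l i <;> simp [hq, h]
  · rw [traceNorm_diagonalization hW, overlap, diagonalization_mul hW, trace_diagonalization hW,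
      Complex.re_sum, Finset.mul_sum, ← add_zero (∑ i, |l i|), ← htr, ← Finset.sum_add_distrib]
    refine Finset.sum_congr rfl fun i _ => ?_
    by_cases h : 0 ≤ l i
    · simp [hq, h, abs_of_nonneg h]; ring
    · simp [hq, h, abs_of_neg (not_le.1 h)]

/-! ### States, effects and the trace distance -/

lemma conj_diagonalization {W : Op D} (hW : Wᴴ * W = 1) (d : Op D) :
    Wᴴ * (W * d * Wᴴ) * W = d := by
  calc _ = (Wᴴ * W) * d * (Wᴴ * W) := by simp only [Matrix.mul_assoc]
    _ = _ := by rw [hW, Matrix.one_mul, Matrix.mul_one]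

lemma diagonalization_nonneg {W : Op D} (hW : Wᴴ * W = 1) {l : Fin D → ℝ}
    (h : (W * diagonal (fun i => (l i : ℂ)) * Wᴴ).PosSemidef) (i : Fin D) : 0 ≤ l i := by
  have h := (h.conjTranspose_mul_mul_same W).diag_nonneg (i := i)
  rw [conj_diagonalization hW] at h
  simpa using h

/-- The trace pairing of two positive operators is nonnegative. -/
lemma overlap_nonneg {A B : Op D} (hA : A.PosSemidef) (hB : B.PosSemidef) : 0 ≤ overlap A B := by
  obtain ⟨W, hW, -, l, rfl⟩ := exists_diagonalization hA.1
  rw [overlap_diagonalization]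
  exact Finset.sum_nonneg fun i _ => mul_nonneg (diagonalization_nonneg hW hA i)
    (Complex.nonneg_iff.1 (hB.conjTranspose_mul_mul_same W).diag_nonneg).1

lemma posSemidef_of_projector {Q : Op D} (h : Qᴴ = Q) (h2 : Q * Q = Q) : Q.PosSemidef := by
  have := posSemidef_conjTranspose_mul_self Q
  rwa [h, h2] at this

lemma posSemidef_one_sub_of_projector {Q : Op D} (h : Qᴴ = Q) (h2 : Q * Q = Q) :
    (1 - Q).PosSemidef := by
  refine posSemidef_of_projector (by simp [h]) ?_
  rw [Matrix.mul_sub, Matrix.sub_mul, Matrix.sub_mul]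
  simp [h2]

lemma overlap_proj_nonneg {A : Op D} (hA : A.PosSemidef) (v : Fin D → ℂ) :
    0 ≤ overlap A (proj v) := overlap_nonneg hA (posSemidef_proj v)

/-- A positive operator is bounded by its trace. -/
lemma overlap_proj_le_trace {A : Op D} (hA : A.PosSemidef) (v : Fin D → ℂ) :
    overlap A (proj v) ≤ A.trace.re * ∑ i, ‖v i‖ ^ 2 := by
  obtain ⟨W, hW, hW', l, rfl⟩ := exists_diagonalization hA.1
  have hl := diagonalization_nonneg hW hA
  rw [trace_diagonalization hW, overlap_diagonalization, Complex.re_sum, Finset.sum_mul]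
  refine Finset.sum_le_sum fun i _ => ?_
  simp only [Complex.ofReal_re]
  refine mul_le_mul_of_nonneg_left ?_ (hl i)
  have h0 : ∀ i, 0 ≤ ((Wᴴ * proj v * W) i i).re := fun i =>
    (Complex.nonneg_iff.1 ((posSemidef_proj v).conjTranspose_mul_mul_same W).diag_nonneg).1
  have htr : (Wᴴ * proj v * W).trace = ((∑ i, ‖v i‖ ^ 2 : ℝ) : ℂ) := by
    rw [Matrix.mul_assoc, trace_mul_comm, Matrix.mul_assoc, hW', Matrix.mul_one, trace_proj]
  have := congrArg Complex.re htr
  rw [trace, Complex.re_sum, Complex.ofReal_re] at this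
  rw [← this]
  exact Finset.single_le_sum (f := fun i => ((Wᴴ * proj v * W) i i).re) (fun i _ => h0 i)
    (Finset.mem_univ i)

lemma IsState.one_sub {ρ : Op D} (h : IsState ρ) : (1 - ρ).PosSemidef := by
  refine .of_dotProduct_mulVec_nonneg (isHermitian_one.sub h.1.1) fun x => ?_
  have hH : (1 - ρ).IsHermitian := isHermitian_one.sub h.1.1
  have him : (star x ⬝ᵥ ((1 - ρ) *ᵥ x)).im = 0 := hH.im_star_dotProduct_mulVec_self x
  refine Complex.nonneg_iff.2 ⟨?_, him.symm⟩
  rw [← overlap_proj, overlap_sub_left]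
  have h1 := overlap_proj_le_trace h.1 x
  rw [h.2] at h1
  rw [overlap_comm 1, overlap_one_right, trace_proj, Complex.ofReal_re]
  simp at h1
  linarith

lemma IsState.isHermitian_sub {ρ σ : Op D} (h : IsState ρ) (h' : IsState σ) :
    (ρ - σ).IsHermitian := h.1.1.sub h'.1.1

lemma IsState.trace_sub {ρ σ : Op D} (h : IsState ρ) (h' : IsState σ) :
    (ρ - σ).trace = 0 := by rw [Matrix.trace_sub, h.2, h'.2, sub_self]

lemma traceNorm_neg (A : Op D) : traceNorm (-A) = traceNorm A := by
  simp only [traceNorm, conjTranspose_neg, Matrix.neg_mul, Matrix.mul_neg, neg_neg]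

lemma traceNorm_sub_comm (A B : Op D) : traceNorm (A - B) = traceNorm (B - A) := by
  rw [← traceNorm_neg, neg_sub]

/-- Replacing a state by another changes its overlap with a third one by at most half of the trace
distance. -/
lemma abs_overlap_sub_le {ρ σ τ : Op D} (h : IsState ρ) (h' : IsState σ) (hτ : IsState τ) :
    |overlap ρ τ - overlap σ τ| ≤ traceNorm (ρ - σ) / 2 := by
  rw [abs_le, ← overlap_sub_left]
  have h1 := overlap_le_traceNorm_div_two (h.isHermitian_sub h') (h.trace_sub h') hτ.1 hτ.one_sub
  have h2 := overlap_le_traceNorm_div_two (h'.isHermitian_sub h) (h'.trace_sub h) hτ.1 hτ.one_sub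
  rw [traceNorm_sub_comm] at h2
  rw [overlap_sub_left] at *
  constructor <;> linarith

lemma traceNorm_sub_le {ρ σ τ : Op D} (h : IsState ρ) (h' : IsState σ) (hτ : IsState τ) :
    traceNorm (ρ - τ) ≤ traceNorm (ρ - σ) + traceNorm (σ - τ) := by
  obtain ⟨Q, hQ, hQ2, hQn⟩ := exists_projector_traceNorm (h.isHermitian_sub hτ) (h.trace_sub hτ)
  have hp := posSemidef_of_projector hQ hQ2
  have hp' := posSemidef_one_sub_of_projector hQ hQ2
  have h1 := overlap_le_traceNorm_div_two (h.isHermitian_sub h') (h.trace_sub h') hp hp'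
  have h2 := overlap_le_traceNorm_div_two (h'.isHermitian_sub hτ) (h'.trace_sub hτ) hp hp'
  rw [hQn]
  rw [overlap_sub_left] at *
  linarith

lemma traceNorm_sub_le_two {ρ σ : Op D} (h : IsState ρ) (h' : IsState σ) :
    traceNorm (ρ - σ) ≤ 2 := by
  obtain ⟨Q, hQ, hQ2, hQn⟩ := exists_projector_traceNorm (h.isHermitian_sub h') (h.trace_sub h')
  have h1 := overlap_nonneg h.1 (posSemidef_one_sub_of_projector hQ hQ2)
  have h2 := overlap_nonneg h'.1 (posSemidef_of_projector hQ hQ2)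
  rw [overlap_sub_right, overlap_one_right, h.2, Complex.one_re] at h1
  rw [hQn, overlap_sub_left]
  linarith

/-- The Cauchy–Schwarz inequality for the form `v ↦ v† ρ v`. -/
lemma re_dotProduct_mulVec_sq_le {ρ : Op D} (h : ρ.PosSemidef) (u v : Fin D → ℂ) :
    (star u ⬝ᵥ (ρ *ᵥ v)).re ^ 2 ≤ overlap ρ (proj u) * overlap ρ (proj v) := by
  have key : ∀ t : ℝ, 0 ≤ overlap ρ (proj u) * (t * t) + 2 * (star u ⬝ᵥ (ρ *ᵥ v)).re * t +
      overlap ρ (proj v) := by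
    intro t
    have h0 := overlap_proj_nonneg h ((t : ℂ) • u + v)
    have hs : (star v ⬝ᵥ (ρ *ᵥ u)).re = (star u ⬝ᵥ (ρ *ᵥ v)).re := by
      have : star v ⬝ᵥ (ρ *ᵥ u) = star (star u ⬝ᵥ (ρ *ᵥ v)) := by
        rw [star_dotProduct, star_mulVec, h.1.eq, ← dotProduct_mulVec]
      rw [this]; simp
    rw [overlap_proj] at h0 ⊢
    rw [overlap_proj]
    simp only [star_add, star_smul, mulVec_add, mulVec_smul, dotProduct_add, add_dotProduct,
      smul_dotProduct, dotProduct_smul, smul_eq_mul, Complex.add_re] at h0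
    simp [hs] at h0
    linarith
  have := discrim_le_zero key
  rw [discrim] at this
  nlinarith

lemma proj_mulVec_eq (R : Op D) (v : Fin D → ℂ) : proj (R *ᵥ v) = R * proj v * Rᴴ := by
  rw [proj, proj, star_mulVec, mul_vecMulVec, vecMulVec_mul]

lemma overlap_conj (R A B : Op D) : overlap (R * A * Rᴴ) B = overlap A (Rᴴ * B * R) := by
  rw [overlap, overlap, show R * A * Rᴴ * B = R * (A * Rᴴ * B) by simp only [Matrix.mul_assoc],
    trace_mul_comm]
  simp only [Matrix.mul_assoc]

lemma sum_norm_sq_eq (v : Fin D → ℂ) : ∑ i, ‖v i‖ ^ 2 = (proj v).trace.re := by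
  rw [trace_proj, Complex.ofReal_re]

/-- The inequality of Fuchs and van de Graaf for a pure second state. -/
lemma traceNorm_sub_proj_le {ρ : Op D} {v : Fin D → ℂ} (h : IsState ρ)
    (hv : ∑ i, ‖v i‖ ^ 2 = 1) :
    traceNorm (ρ - proj v) ≤ 2 * √(1 - overlap ρ (proj v)) := by
  have hP := isState_proj hv
  obtain ⟨Q, hQ, hQ2, hQn⟩ := exists_projector_traceNorm (h.isHermitian_sub hP) (h.trace_sub hP)
  have hQp := posSemidef_of_projector hQ hQ2
  have hQp' := posSemidef_one_sub_of_projector hQ hQ2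
  rw [hQn]
  refine mul_le_mul_of_nonneg_left (Real.le_sqrt_of_sq_le ?_) zero_le_two
  have aux : ∀ R : Op D, Rᴴ = R → R * R = R →
      overlap ρ (proj (R *ᵥ v)) ≤ overlap ρ R * overlap (proj v) R := by
    intro R hR hR2
    have h1 := overlap_proj_le_trace (h.1.mul_mul_conjTranspose_same R) (R *ᵥ v)
    have e1 : overlap (R * ρ * Rᴴ) (proj (R *ᵥ v)) = overlap ρ (proj (R *ᵥ v)) := by
      rw [overlap_conj, proj_mulVec_eq, hR]
      congr 1
      calc _ = (R * R) * proj v * (R * R) := by simp only [Matrix.mul_assoc]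
        _ = _ := by rw [hR2]
    have e2 : ∀ B : Op D, (R * B * Rᴴ).trace.re = overlap B R := by
      intro B
      rw [← overlap_one_right, overlap_conj, Matrix.mul_one, hR, hR2]
    rw [e1, e2, sum_norm_sq_eq, proj_mulVec_eq, e2, ← proj_mulVec_eq] at h1
    exact h1
  have hQ' : (1 - Q)ᴴ = 1 - Q := by simp [hQ]
  have hQ2' : (1 - Q) * (1 - Q) = 1 - Q := by
    rw [Matrix.mul_sub, Matrix.sub_mul, Matrix.sub_mul]; simp [hQ2]
  have a1 := aux Q hQ hQ2
  have a2 := aux (1 - Q) hQ' hQ2'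
  have c := re_dotProduct_mulVec_sq_le h.1 (Q *ᵥ v) ((1 - Q) *ᵥ v)
  have hsplit : overlap ρ (proj v) = overlap ρ (proj (Q *ᵥ v)) + overlap ρ (proj ((1 - Q) *ᵥ v))
      + 2 * (star (Q *ᵥ v) ⬝ᵥ (ρ *ᵥ ((1 - Q) *ᵥ v))).re := by
    have hv' : v = Q *ᵥ v + (1 - Q) *ᵥ v := by rw [← add_mulVec]; simp
    set a := Q *ᵥ v
    set b := (1 - Q) *ᵥ v
    have hs : (star b ⬝ᵥ (ρ *ᵥ a)).re = (star a ⬝ᵥ (ρ *ᵥ b)).re := by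
      have : star b ⬝ᵥ (ρ *ᵥ a) = star (star a ⬝ᵥ (ρ *ᵥ b)) := by
        rw [star_dotProduct, star_mulVec, h.1.1.eq, ← dotProduct_mulVec]
      rw [this]; simp
    rw [hv', overlap_proj, overlap_proj, overlap_proj]
    simp only [star_add, mulVec_add, dotProduct_add, add_dotProduct, Complex.add_re, hs]
    ring
  have p0 := overlap_nonneg h.1 hQp
  have q0 := overlap_nonneg hP.1 hQp
  have p1 := overlap_nonneg h.1 hQp'
  have q1 := overlap_nonneg hP.1 hQp'
  rw [overlap_sub_right, overlap_one_right, h.2, Complex.one_re] at p1 a2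
  rw [overlap_sub_right, overlap_one_right, hP.2, Complex.one_re] at q1 a2
  rw [overlap_sub_left]
  set p := overlap ρ Q
  set q := overlap (proj v) Q
  set X := (star (Q *ᵥ v) ⬝ᵥ (ρ *ᵥ ((1 - Q) *ᵥ v))).re
  -- The geometric mean of `p (1 - p)` and `q (1 - q)` is at most their arithmetic mean.
  have hX : 2 * X ≤ p * (1 - p) + q * (1 - q) := by
    have hpp := mul_nonneg p0 p1
    have hqq := mul_nonneg q0 q1
    refine le_of_abs_le (abs_le_of_sq_le_sq ?_ (by positivity))
    have : X ^ 2 ≤ (p * (1 - p)) * (q * (1 - q)) := by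
      refine c.trans ((mul_le_mul a1 a2 (overlap_proj_nonneg h.1 _) (by positivity)).trans ?_)
      apply le_of_eq; ring
    nlinarith [sq_nonneg (p * (1 - p) - q * (1 - q))]
  nlinarith

/-- A state of purity at least `1 - δ` is within `2 δ` of the projector onto its leading
eigenvector. -/
lemma exists_pure_approx {ρ : Op D} (h : IsState ρ) {δ : ℝ} (hδ : 1 - overlap ρ ρ ≤ δ) :
    ∃ v : Fin D → ℂ, ∑ i, ‖v i‖ ^ 2 = 1 ∧ traceNorm (ρ - proj v) ≤ 2 * δ := by
  obtain ⟨W, hW, -, l, rfl⟩ := exists_diagonalization h.1.1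
  have hl := diagonalization_nonneg hW h.1
  have hl1 : ∑ i, l i = 1 := by
    have := h.2
    rw [trace_diagonalization hW] at this
    exact_mod_cast this
  have hne : (Finset.univ : Finset (Fin D)).Nonempty := by
    by_contra hne
    rw [Finset.not_nonempty_iff_eq_empty] at hne
    simp [hne] at hl1
  obtain ⟨m, -, hm⟩ := Finset.exists_max_image Finset.univ l hne
  have hsq : overlap (W * diagonal (fun i => (l i : ℂ)) * Wᴴ)
      (W * diagonal (fun i => (l i : ℂ)) * Wᴴ) = ∑ i, l i * l i := by
    rw [overlap, diagonalization_mul hW, trace_diagonalization hW, Complex.re_sum]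
    simp
  have hle : ∑ i, l i * l i ≤ l m := by
    calc _ ≤ ∑ i, l m * l i := Finset.sum_le_sum fun i hi =>
          mul_le_mul_of_nonneg_right (hm i hi) (hl i)
      _ = _ := by rw [← Finset.mul_sum, hl1, mul_one]
  have hproj : proj (W *ᵥ Pi.single m 1) =
      W * diagonal (fun i => ((if i = m then 1 else 0 : ℝ) : ℂ)) * Wᴴ := by
    rw [proj_mulVec_eq]
    congr 2
    ext i j
    rcases eq_or_ne i m with rfl | hi
    · rcases eq_or_ne i j with rfl | hj
      · simp [proj, vecMulVec_apply]
      · simp [proj, vecMulVec_apply, hj, hj.symm]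
    · simp [proj, vecMulVec_apply, diagonal_apply, hi]
  refine ⟨W *ᵥ Pi.single m 1, ?_, ?_⟩
  · rw [sum_norm_sq_eq, hproj, trace_diagonalization hW, Complex.re_sum]
    simp
  · have hsub : W * diagonal (fun i => (l i : ℂ)) * Wᴴ - proj (W *ᵥ Pi.single m 1) =
        W * diagonal (fun i => ((l i - if i = m then 1 else 0 : ℝ) : ℂ)) * Wᴴ := by
      rw [hproj, ← Matrix.sub_mul, ← Matrix.mul_sub, diagonal_sub]
      congr 3; ext i; push_cast; rfl
    rw [hsub, traceNorm_diagonalization hW]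
    have hlm : l m ≤ 1 := hl1 ▸ Finset.single_le_sum (fun i _ => hl i) (Finset.mem_univ m)
    have : ∀ i, |l i - if i = m then 1 else 0| = l i + if i = m then 1 - 2 * l m else 0 := by
      intro i
      rcases eq_or_ne i m with rfl | hi
      · rw [if_pos rfl, if_pos rfl, abs_of_nonpos (by linarith)]; ring
      · rw [if_neg hi, if_neg hi, sub_zero, add_zero, abs_of_nonneg (hl i)]
    simp_rw [this]
    rw [Finset.sum_add_distrib, hl1, Finset.sum_ite_eq' Finset.univ m]
    simp only [Finset.mem_univ, if_true]
    rw [hsq] at hδ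
    linarith

/-! ### Unitary and anti-unitary conjugations -/

lemma IsState.conj {ρ : Op D} (h : IsState ρ) {V : Op D} (hV : Vᴴ * V = 1) :
    IsState (V * ρ * Vᴴ) :=
  ⟨h.1.mul_mul_conjTranspose_same V, by
    rw [trace_mul_comm, ← Matrix.mul_assoc, hV, Matrix.one_mul, h.2]⟩

lemma overlap_conj_conj {V : Op D} (hV : Vᴴ * V = 1) (A B : Op D) :
    overlap (V * A * Vᴴ) (V * B * Vᴴ) = overlap A B := by
  rw [overlap_conj, conj_diagonalization hV]

lemma traceNorm_conj_sub {V : Op D} (hV : Vᴴ * V = 1) (A B : Op D) :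
    traceNorm (V * A * Vᴴ - V * B * Vᴴ) = traceNorm (A - B) := by
  have : (V * A * Vᴴ - V * B * Vᴴ)ᴴ * (V * A * Vᴴ - V * B * Vᴴ) =
      V * ((A - B)ᴴ * (A - B)) * Vᴴ := by
    rw [← Matrix.sub_mul, ← Matrix.mul_sub]
    simp only [conjTranspose_mul, conjTranspose_conjTranspose]
    calc _ = V * (A - B)ᴴ * (Vᴴ * V) * (A - B) * Vᴴ := by simp only [Matrix.mul_assoc]
      _ = _ := by rw [hV]; simp only [Matrix.mul_assoc, Matrix.one_mul]
  have hc : ((V * A * Vᴴ - V * B * Vᴴ)ᴴ * (V * A * Vᴴ - V * B * Vᴴ)).charpoly =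
      ((A - B)ᴴ * (A - B)).charpoly := by
    rw [this, charpoly_mul_comm, ← Matrix.mul_assoc, hV, Matrix.one_mul]
  rw [traceNorm, traceNorm, ((isHermitian_conjTranspose_mul_self _).eigenvalues_eq_eigenvalues_iff
    (isHermitian_conjTranspose_mul_self _)).2 hc]

/-- The entrywise complex conjugate `K ρ K` of an operator. -/
abbrev cc (A : Op D) : Op D := A.map (starRingEnd ℂ)

lemma cc_mul (A B : Op D) : cc (A * B) = cc A * cc B := Matrix.map_mul

lemma cc_conjTranspose (A : Op D) : cc Aᴴ = (cc A)ᴴ := by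
  ext i j; simp [cc]

lemma cc_cc (A : Op D) : cc (cc A) = A := by
  ext i j; simp [cc]

lemma cc_sub (A B : Op D) : cc (A - B) = cc A - cc B := by
  ext i j; simp [cc]

lemma trace_cc (A : Op D) : (cc A).trace = star A.trace := by
  simp [trace, cc]

lemma overlap_cc_cc (A B : Op D) : overlap (cc A) (cc B) = overlap A B := by
  rw [overlap, ← cc_mul, trace_cc, overlap]; simp

lemma IsState.cc {ρ : Op D} (h : IsState ρ) : IsState (cc ρ) := by
  refine ⟨?_, by rw [trace_cc, h.2, star_one]⟩
  have : RobustWigner.cc ρ = ρᵀ := by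
    ext i j
    exact h.1.1.apply j i
  rw [this]
  exact h.1.transpose

lemma traceNorm_cc_sub {ρ σ : Op D} (h : IsState ρ) (h' : IsState σ) :
    traceNorm (cc ρ - cc σ) = traceNorm (ρ - σ) := by
  have key : ∀ {ρ σ : Op D}, IsState ρ → IsState σ →
      traceNorm (RobustWigner.cc ρ - RobustWigner.cc σ) ≤ traceNorm (ρ - σ) := by
    intro ρ σ h h'
    obtain ⟨Q, hQ, hQ2, hQn⟩ := exists_projector_traceNorm (h.cc.isHermitian_sub h'.cc)
      (h.cc.trace_sub h'.cc)
    have hcQ : (RobustWigner.cc Q)ᴴ = RobustWigner.cc Q := by rw [← cc_conjTranspose, hQ]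
    have hcQ2 : RobustWigner.cc Q * RobustWigner.cc Q = RobustWigner.cc Q := by
      rw [← cc_mul, hQ2]
    have := overlap_le_traceNorm_div_two (h.isHermitian_sub h') (h.trace_sub h')
      (posSemidef_of_projector hcQ hcQ2) (posSemidef_one_sub_of_projector hcQ hcQ2)
    rw [← overlap_cc_cc, cc_sub, cc_cc] at this
    rw [hQn]
    linarith
  refine le_antisymm (key h h') ?_
  have := key h.cc h'.cc
  rwa [cc_cc, cc_cc] at this

lemma proj_star (v : Fin D → ℂ) : proj (star v) = cc (proj v) := by
  ext i j
  simp [proj, vecMulVec_apply]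

/-! ### Symmetric orthogonalization -/

lemma diagonalization_apply_self (W : Op D) (a : Fin D → ℝ) (k : Fin D) :
    (W * diagonal (fun i => (a i : ℂ)) * Wᴴ) k k = ((∑ i, ‖W k i‖ ^ 2 * a i : ℝ) : ℂ) := by
  rw [Matrix.mul_apply, Complex.ofReal_sum]
  refine Finset.sum_congr rfl fun i _ => ?_
  rw [mul_diagonal, conjTranspose_apply]
  push_cast
  rw [← Complex.mul_conj', RCLike.star_def]
  ring

/-- The Taylor bound for the square root around `1` that holds on `[1/4, ∞)`. -/
lemma taylor_le_sqrt {g : ℝ} (hg : 1 / 4 ≤ g) : 1 + (g - 1) / 2 - (g - 1) ^ 2 / 4 ≤ √g := by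
  have h1 : 1 / 2 ≤ √g := Real.le_sqrt_of_sq_le (by linarith)
  obtain ⟨s, hs⟩ : ∃ s, √g = s := ⟨_, rfl⟩
  have h2 : g = s ^ 2 := by rw [← hs, Real.sq_sqrt (by linarith)]
  rw [hs] at h1 ⊢
  rw [h2]
  nlinarith [mul_nonneg (sq_nonneg (s - 1)) (show (0 : ℝ) ≤ (s + 1) ^ 2 - 2 by nlinarith)]

/-- Löwdin's symmetric orthogonalization: almost orthonormal vectors `z k`, the columns of a
matrix `A`, are taken to the columns of the square root of the Gram matrix `A† A` by the unitary
part of the polar decomposition of `A`. -/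
lemma exists_unitary_of_almost_orthonormal {z : Fin D → Fin D → ℂ} {ε : ℝ}
    (hz : ∀ k, ∑ i, ‖z k i‖ ^ 2 = 1) (hε : ∀ j k, j ≠ k → ‖star (z j) ⬝ᵥ z k‖ ^ 2 ≤ ε)
    (hsmall : (D : ℝ) * ((D - 1) * ε) ≤ 9 / 16) :
    ∃ V : Op D, Vᴴ * V = 1 ∧ V * Vᴴ = 1 ∧
      ∀ k, ∃ r : ℝ, (V *ᵥ z k) k = r ∧ 1 - (D - 1) * ε / 4 ≤ r := by
  set A : Op D := Matrix.of (fun i k => z k i) with hA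
  obtain ⟨G, hGdef⟩ : ∃ G : Op D, G = Aᴴ * A := ⟨_, rfl⟩
  have hGapp : ∀ j k, G j k = star (z j) ⬝ᵥ z k := fun j k => by
    simp [hGdef, hA, Matrix.mul_apply, dotProduct]
  have hGpos : G.PosSemidef := hGdef ▸ posSemidef_conjTranspose_mul_self A
  have hG1 : ∀ k, G k k = 1 := fun k => by
    rw [hGapp, star_dotProduct_self, hz]; simp
  have hGG : ∀ k, ((G * G) k k).re ≤ 1 + (D - 1) * ε := by
    intro k
    have : (G * G) k k = ((∑ j, ‖G k j‖ ^ 2 : ℝ) : ℂ) := by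
      rw [Matrix.mul_apply, Complex.ofReal_sum]
      refine Finset.sum_congr rfl fun j _ => ?_
      rw [← hGpos.1.apply j k, RCLike.star_def, Complex.mul_conj']
      simp
    rw [this, Complex.ofReal_re, ← Finset.add_sum_erase _ _ (Finset.mem_univ k), hG1]
    have : ∑ j ∈ Finset.univ.erase k, ‖G k j‖ ^ 2 ≤ ∑ j ∈ Finset.univ.erase k, ε :=
      Finset.sum_le_sum fun j hj => by
        rw [hGapp]; exact hε k j (Finset.ne_of_mem_erase hj).symm
    rw [Finset.sum_const, Finset.card_erase_of_mem (Finset.mem_univ k), Finset.card_univ,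
      Fintype.card_fin, nsmul_eq_mul, Nat.cast_sub (Nat.one_le_of_lt k.2), Nat.cast_one] at this
    simpa using this
  obtain ⟨W, hW, hW', g, hg⟩ := exists_diagonalization hGpos.1
  have hGGd : G * G = W * diagonal (fun i => ((g i ^ 2 : ℝ) : ℂ)) * Wᴴ := by
    rw [hg, diagonalization_mul hW]
    congr 3; ext i; push_cast; ring
  have htr : ∑ i, g i = D := by
    have h1 : G.trace = (D : ℂ) := by simp [trace, hG1]
    rw [hg, trace_diagonalization hW] at h1
    exact_mod_cast h1
  have htr2 : ∑ i, g i ^ 2 ≤ D + D * ((D - 1) * ε) := by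
    have h1 : (G * G).trace.re ≤ ∑ k : Fin D, (1 + (D - 1) * ε) := by
      rw [trace, Complex.re_sum]
      exact Finset.sum_le_sum fun k _ => hGG k
    rw [hGGd, trace_diagonalization hW, ← Complex.ofReal_sum, Complex.ofReal_re] at h1
    simp at h1
    linarith
  -- The Hilbert–Schmidt norm of `G - 1` keeps the spectrum of `G` away from zero.
  have hglow : ∀ i, 1 / 4 ≤ g i := by
    intro i
    have h1 : (g i - 1) ^ 2 ≤ ∑ i, (g i - 1) ^ 2 :=
      Finset.single_le_sum (f := fun i => (g i - 1) ^ 2) (fun i _ => sq_nonneg _)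
        (Finset.mem_univ i)
    have h2 : ∑ i, (g i - 1) ^ 2 = ∑ i, g i ^ 2 - 2 * ∑ i, g i + D := by
      rw [Finset.mul_sum, ← Finset.sum_sub_distrib]
      have : (D : ℝ) = ∑ i : Fin D, 1 := by simp
      rw [this, ← Finset.sum_add_distrib]
      exact Finset.sum_congr rfl fun i _ => by ring
    rw [htr] at h2
    nlinarith
  have hgpos : ∀ i, 0 < √(g i) := fun i => Real.sqrt_pos.2 (by linarith [hglow i])
  set R : Op D := W * diagonal (fun i => (((√(g i))⁻¹ : ℝ) : ℂ)) * Wᴴ with hR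
  have hRH : Rᴴ = R := diagonalization_conjTranspose W _
  have hRG : R * G = W * diagonal (fun i => ((√(g i) : ℝ) : ℂ)) * Wᴴ := by
    rw [hg, hR, diagonalization_mul hW]
    congr 3; ext i
    rw [← Complex.ofReal_mul]
    congr 1
    rw [inv_mul_eq_iff_eq_mul₀ (hgpos i).ne', Real.mul_self_sqrt (by linarith [hglow i])]
  have hVV : (R * Aᴴ) * (R * Aᴴ)ᴴ = 1 := by
    rw [conjTranspose_mul, conjTranspose_conjTranspose, hRH]
    calc _ = R * (Aᴴ * A) * R := by simp only [Matrix.mul_assoc]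
      _ = 1 := by
        rw [← hGdef, hRG, hR, diagonalization_mul hW]
        have : (fun i => ((√(g i) : ℝ) : ℂ) * (((√(g i))⁻¹ : ℝ) : ℂ)) = fun _ => 1 := by
          ext i
          rw [← Complex.ofReal_mul, mul_inv_cancel₀ (hgpos i).ne', Complex.ofReal_one]
        rw [this, diagonal_one, Matrix.mul_one, hW']
  refine ⟨R * Aᴴ, mul_eq_one_comm.1 hVV, hVV, fun k => ⟨∑ i, ‖W k i‖ ^ 2 * √(g i), ?_, ?_⟩⟩
  · have : ((R * Aᴴ) *ᵥ z k) k = (R * G) k k := by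
      rw [hGdef, ← Matrix.mul_assoc, Matrix.mul_apply]
      rfl
    rw [this, hRG, diagonalization_apply_self]
  · have e0 : ∑ i, ‖W k i‖ ^ 2 = 1 := by
      have := diagonalization_apply_self W (fun _ => 1) k
      simp only [Complex.ofReal_one, diagonal_one, hW', one_apply_eq,
        mul_one] at this
      exact_mod_cast this.symm
    have e1 : ∑ i, ‖W k i‖ ^ 2 * g i = 1 := by
      have := diagonalization_apply_self W g k
      rw [← hg, hG1] at this
      exact_mod_cast this.symm
    have e2 : ∑ i, ‖W k i‖ ^ 2 * g i ^ 2 ≤ 1 + (D - 1) * ε := by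
      have := diagonalization_apply_self W (fun i => g i ^ 2) k
      rw [← hGGd] at this
      have h2 := hGG k
      rwa [this, Complex.ofReal_re] at h2
    have e3 : ∑ i, ‖W k i‖ ^ 2 * (1 + (g i - 1) / 2 - (g i - 1) ^ 2 / 4) ≤
        ∑ i, ‖W k i‖ ^ 2 * √(g i) :=
      Finset.sum_le_sum fun i _ =>
        mul_le_mul_of_nonneg_left (taylor_le_sqrt (hglow i)) (sq_nonneg _)
    have e4 : ∑ i, ‖W k i‖ ^ 2 * (1 + (g i - 1) / 2 - (g i - 1) ^ 2 / 4) =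
        1 / 4 * ∑ i, ‖W k i‖ ^ 2 + ∑ i, ‖W k i‖ ^ 2 * g i
          - 1 / 4 * ∑ i, ‖W k i‖ ^ 2 * g i ^ 2 := by
      rw [Finset.mul_sum, Finset.mul_sum, ← Finset.sum_add_distrib, ← Finset.sum_sub_distrib]
      exact Finset.sum_congr rfl fun i _ => by ring
    rw [e4, e0, e1] at e3
    linarith

/-! ### Overlaps with the reference states in terms of matrix entries -/

/-- The three-level vector with amplitudes `a`, `b`, `c` at the positions `i`, `j`, `l`. -/
noncomputable def threeLevel (i j l : Fin D) (a b c : ℂ) : Fin D → ℂ :=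
  a • Pi.single i 1 + b • Pi.single j 1 + c • Pi.single l 1

lemma overlap_threeLevel {A : Op D} (hA : A.IsHermitian) (i j l : Fin D) (a b c : ℂ) :
    overlap A (proj (threeLevel i j l a b c)) =
      ‖a‖ ^ 2 * (A i i).re + ‖b‖ ^ 2 * (A j j).re + ‖c‖ ^ 2 * (A l l).re
        + 2 * (star a * b * A i j).re + 2 * (star b * c * A j l).re
        + 2 * (star a * c * A i l).re := by
  have h1 : A j i = star (A i j) := (hA.apply j i).symm
  have h2 : A l j = star (A j l) := (hA.apply l j).symm
  have h3 : A l i = star (A i l) := (hA.apply l i).symm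
  have hi : (A i i).im = 0 := by
    have := congrArg Complex.im (hA.apply i i); simp at this; linarith
  have hj : (A j j).im = 0 := by
    have := congrArg Complex.im (hA.apply j j); simp at this; linarith
  have hl : (A l l).im = 0 := by
    have := congrArg Complex.im (hA.apply l l); simp at this; linarith
  have hs : ∀ k : Fin D, star (Pi.single k (1 : ℂ) : Fin D → ℂ) = Pi.single k 1 := fun k => by
    rw [← Pi.single_star, star_one]
  rw [overlap_proj, threeLevel]
  simp only [star_add, star_smul, mulVec_add, mulVec_smul, dotProduct_add, add_dotProduct,
    smul_dotProduct, dotProduct_smul, mulVec_single_one, hs, single_one_dotProduct, col_apply,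
    smul_eq_mul, h1, h2, h3, Complex.add_re, Complex.mul_re, Complex.add_im, Complex.mul_im, RCLike.star_def,
    Complex.conj_re, Complex.conj_im, hi, hj, hl, Complex.sq_norm, Complex.normSq_apply]
  ring

lemma ket_eq_single {n : ℕ} (h : n < D) : ket D n = Pi.single ⟨n, h⟩ 1 := by
  ext i
  simp [ket, Pi.single_apply, Fin.ext_iff]

/-- The lower end of the edge `k` of the path `0, …, D - 1`. -/
def lo (k : Fin (D - 1)) : Fin D := ⟨k, by omega⟩

/-- The upper end of the edge `k` of the path `0, …, D - 1`. -/
def hi (k : Fin (D - 1)) : Fin D := ⟨k + 1, by omega⟩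

lemma lo_ne_hi (k : Fin (D - 1)) : lo k ≠ hi k := by
  simp [lo, hi, Fin.ext_iff]

/-- The first edge of the triple `k, k + 1, k + 2`. -/
def fstEdge (k : Fin (D - 2)) : Fin (D - 1) := ⟨k, by omega⟩

/-- The second edge of the triple `k, k + 1, k + 2`. -/
def sndEdge (k : Fin (D - 2)) : Fin (D - 1) := ⟨k + 1, by omega⟩

lemma lo_sndEdge (k : Fin (D - 2)) : lo (sndEdge k) = hi (fstEdge k) := rfl

lemma lo_ne_hi_sndEdge (k : Fin (D - 2)) : lo (fstEdge k) ≠ hi (sndEdge k) := by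
  simp [lo, hi, fstEdge, sndEdge, Fin.ext_iff]
  omega

/-- The vector `(|k⟩ + s i |k + 1⟩) / √2`, which is `|Y_k⟩` for `s = 1` and its complex conjugate
for `s = -1`. -/
noncomputable def yVec (s : ℝ) (k : Fin (D - 1)) : Fin D → ℂ :=
  threeLevel (lo k) (hi k) (hi k) ((1 / √2 : ℝ) : ℂ) (((1 / √2 : ℝ) : ℂ) * (s * Complex.I)) 0

/-- The vector `(s i |k⟩ + |k + 1⟩ + s' i |k + 2⟩) / √3`; it is `|YY_k⟩` for `s = s' = 1`. -/
noncomputable def yyVec (s s' : ℝ) (k : Fin (D - 2)) : Fin D → ℂ :=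
  threeLevel (lo (fstEdge k)) (hi (fstEdge k)) (hi (sndEdge k))
    (((1 / √3 : ℝ) : ℂ) * (s * Complex.I)) ((1 / √3 : ℝ) : ℂ)
    (((1 / √3 : ℝ) : ℂ) * (s' * Complex.I))

/-- The vector `|X_k⟩`. -/
noncomputable def xVec (k : Fin (D - 1)) : Fin D → ℂ :=
  threeLevel (lo k) (hi k) (hi k) ((1 / √2 : ℝ) : ℂ) ((1 / √2 : ℝ) : ℂ) 0

/-- The vector `|XX_k⟩`. -/
noncomputable def xxVec (k : Fin (D - 2)) : Fin D → ℂ :=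
  threeLevel (lo (fstEdge k)) (hi (fstEdge k)) (hi (sndEdge k))
    ((1 / √3 : ℝ) : ℂ) ((1 / √3 : ℝ) : ℂ) ((1 / √3 : ℝ) : ℂ)

section refState

variable (ψ : Fin M → Op D)

lemma refState_Z (k : Fin D) : refState ψ (.Z k) = proj (Pi.single k 1) := by
  rw [refState, ket_eq_single k.2]

lemma refState_X (k : Fin (D - 1)) : refState ψ (.X k) = proj (xVec k) := by
  rw [refState, ket_eq_single (by omega), ket_eq_single (by omega), xVec, threeLevel, smul_add,
    zero_smul, add_zero]
  rfl

lemma refState_Y (k : Fin (D - 1)) : refState ψ (.Y k) = proj (yVec 1 k) := by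
  rw [refState, ket_eq_single (by omega), ket_eq_single (by omega), yVec, threeLevel, smul_add,
    zero_smul, add_zero, smul_smul, Complex.ofReal_one, one_mul]
  rfl

lemma refState_XX (k : Fin (D - 2)) : refState ψ (.XX k) = proj (xxVec k) := by
  rw [refState, ket_eq_single (by omega), ket_eq_single (by omega), ket_eq_single (by omega),
    xxVec, threeLevel, smul_add, smul_add]
  rfl

lemma refState_YY (k : Fin (D - 2)) : refState ψ (.YY k) = proj (yyVec 1 1 k) := by
  rw [refState, ket_eq_single (by omega), ket_eq_single (by omega), ket_eq_single (by omega),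
    yyVec, threeLevel, smul_add, smul_add, smul_smul, smul_smul, Complex.ofReal_one, one_mul]
  rfl

end refState

lemma inv_sqrt_two_sq : (1 / √2 : ℝ) ^ 2 = 1 / 2 := by
  rw [div_pow, one_pow, Real.sq_sqrt (by norm_num)]

lemma inv_sqrt_three_sq : (1 / √3 : ℝ) ^ 2 = 1 / 3 := by
  rw [div_pow, one_pow, Real.sq_sqrt (by norm_num)]

lemma overlap_single {A : Op D} (k : Fin D) :
    overlap A (proj (Pi.single k 1)) = (A k k).re := by
  rw [overlap_proj, ← Pi.single_star, star_one, mulVec_single_one, single_one_dotProduct,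
    col_apply]

lemma overlap_xVec {A : Op D} (hA : A.IsHermitian) (k : Fin (D - 1)) :
    overlap A (proj (xVec k)) =
      ((A (lo k) (lo k)).re + (A (hi k) (hi k)).re) / 2 + (A (lo k) (hi k)).re := by
  rw [xVec, overlap_threeLevel hA]
  generalize 1 / √2 = c, inv_sqrt_two_sq = h
  simp
  linear_combination ((A (lo k) (lo k)).re + (A (hi k) (hi k)).re + 2 * (A (lo k) (hi k)).re) * h

lemma overlap_yVec {A : Op D} (hA : A.IsHermitian) {s : ℝ} (hs : s ^ 2 = 1) (k : Fin (D - 1)) :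
    overlap A (proj (yVec s k)) =
      ((A (lo k) (lo k)).re + (A (hi k) (hi k)).re) / 2 - s * (A (lo k) (hi k)).im := by
  rw [yVec, overlap_threeLevel hA]
  generalize 1 / √2 = c, inv_sqrt_two_sq = h
  simp [mul_pow, hs]
  linear_combination ((A (lo k) (lo k)).re + (A (hi k) (hi k)).re
    - 2 * s * (A (lo k) (hi k)).im) * h

lemma overlap_xxVec {A : Op D} (hA : A.IsHermitian) (k : Fin (D - 2)) :
    overlap A (proj (xxVec k)) =
      ((A (lo (fstEdge k)) (lo (fstEdge k))).re + (A (hi (fstEdge k)) (hi (fstEdge k))).re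
        + (A (hi (sndEdge k)) (hi (sndEdge k))).re) / 3
      + 2 / 3 * ((A (lo (fstEdge k)) (hi (fstEdge k))).re
        + (A (hi (fstEdge k)) (hi (sndEdge k))).re + (A (lo (fstEdge k)) (hi (sndEdge k))).re) := by
  rw [xxVec, overlap_threeLevel hA]
  generalize 1 / √3 = c, inv_sqrt_three_sq = h
  generalize lo (fstEdge k) = i, hi (fstEdge k) = j, hi (sndEdge k) = l
  simp
  linear_combination ((A i i).re + (A j j).re + (A l l).re
    + 2 * ((A i j).re + (A j l).re + (A i l).re)) * h

lemma overlap_yyVec {A : Op D} (hA : A.IsHermitian) {s s' : ℝ} (hs : s ^ 2 = 1) (hs' : s' ^ 2 = 1)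
    (k : Fin (D - 2)) :
    overlap A (proj (yyVec s s' k)) =
      ((A (lo (fstEdge k)) (lo (fstEdge k))).re + (A (hi (fstEdge k)) (hi (fstEdge k))).re
        + (A (hi (sndEdge k)) (hi (sndEdge k))).re) / 3
      + 2 / 3 * (s * (A (lo (fstEdge k)) (hi (fstEdge k))).im
        - s' * (A (hi (fstEdge k)) (hi (sndEdge k))).im
        + s * s' * (A (lo (fstEdge k)) (hi (sndEdge k))).re) := by
  rw [yyVec, overlap_threeLevel hA]
  generalize 1 / √3 = c, inv_sqrt_three_sq = h
  generalize lo (fstEdge k) = i, hi (fstEdge k) = j, hi (sndEdge k) = l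
  simp [mul_pow, hs, hs']
  linear_combination ((A i i).re + (A j j).re + (A l l).re
    + 2 * (s * (A i j).im - s' * (A j l).im + s * s' * (A i l).re)) * h

lemma sum_diag_re {ρ : Op D} (h : IsState ρ) : ∑ i, (ρ i i).re = 1 := by
  have := congrArg Complex.re h.2
  rwa [trace, Complex.re_sum] at this

lemma diag_re_nonneg {ρ : Op D} (h : IsState ρ) (i : Fin D) : 0 ≤ (ρ i i).re :=
  (Complex.nonneg_iff.1 h.1.diag_nonneg).1

lemma diag_three_le_one {ρ : Op D} (h : IsState ρ) {i j l : Fin D} (hij : i ≠ j) (hil : i ≠ l)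
    (hjl : j ≠ l) : (ρ i i).re + (ρ j j).re + (ρ l l).re ≤ 1 := by
  rw [← sum_diag_re h]
  have := Finset.sum_le_sum_of_subset_of_nonneg (Finset.subset_univ ({i, j, l} : Finset (Fin D)))
    (fun m _ _ => diag_re_nonneg h m)
  rw [Finset.sum_insert (by simp [hij, hil]), Finset.sum_insert (by simp [hjl]),
    Finset.sum_singleton] at this
  linarith

/-- The path Laplacian on three sites, the parent Hamiltonian of `|XX_k⟩`, detects this vector
among all states. -/
lemma one_sub_overlap_xxVec_le {ρ : Op D} (h : IsState ρ) (k : Fin (D - 2)) :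
    1 - overlap ρ (proj (xxVec k)) ≤
      2 + 2 * overlap ρ (proj (Pi.single (hi (fstEdge k)) 1))
        - 2 * overlap ρ (proj (xVec (fstEdge k))) - 2 * overlap ρ (proj (xVec (sndEdge k))) := by
  have hw := overlap_proj_nonneg h.1
    (threeLevel (lo (fstEdge k)) (hi (fstEdge k)) (hi (sndEdge k)) 1 (-2) 1)
  have ht := diag_three_le_one h (lo_ne_hi (fstEdge k)) (lo_ne_hi_sndEdge k)
    (lo_sndEdge k ▸ lo_ne_hi (sndEdge k))
  rw [overlap_threeLevel h.1.1] at hw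
  rw [overlap_xxVec h.1.1, overlap_xVec h.1.1, overlap_xVec h.1.1, overlap_single, lo_sndEdge]
  norm_num at hw
  linarith

/-- The same for the vectors `yyVec`, whose parent Hamiltonian is built from `yVec`. -/
lemma one_sub_overlap_yyVec_le {ρ : Op D} (h : IsState ρ) {s s' : ℝ} (hs : s ^ 2 = 1)
    (hs' : s' ^ 2 = 1) (k : Fin (D - 2)) :
    1 - overlap ρ (proj (yyVec s s' k)) ≤
      1 - overlap ρ (proj (Pi.single (lo (fstEdge k)) 1))
        + overlap ρ (proj (Pi.single (hi (fstEdge k)) 1))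
        + overlap ρ (proj (Pi.single (hi (sndEdge k)) 1))
        + 2 * overlap ρ (proj (yVec s (fstEdge k)))
        - 2 * overlap ρ (proj (yVec s' (sndEdge k))) := by
  have hw := overlap_proj_nonneg h.1
    (threeLevel (lo (fstEdge k)) (hi (fstEdge k)) (hi (sndEdge k)) (s * Complex.I) (-2)
      (s' * Complex.I))
  rw [overlap_threeLevel h.1.1] at hw
  rw [overlap_yyVec h.1.1 hs hs', overlap_yVec h.1.1 hs, overlap_yVec h.1.1 hs', overlap_single,
    overlap_single, overlap_single, lo_sndEdge]
  simp [hs, hs'] at hw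
  linarith

/-! ### Overlaps among the reference states -/

lemma overlap_one_proj (v : Fin D → ℂ) : overlap 1 (proj v) = ∑ i, ‖v i‖ ^ 2 := by
  rw [overlap_comm, overlap_one_right, sum_norm_sq_eq]

lemma sum_norm_sq_single (k : Fin D) : ∑ i, ‖(Pi.single k 1 : Fin D → ℂ) i‖ ^ 2 = 1 := by
  rw [← overlap_one_proj, overlap_single]; simp

lemma sum_norm_sq_xVec (k : Fin (D - 1)) : ∑ i, ‖xVec k i‖ ^ 2 = 1 := by
  rw [← overlap_one_proj, overlap_xVec isHermitian_one]
  simp [one_apply, lo_ne_hi]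

lemma sum_norm_sq_yVec {s : ℝ} (hs : s ^ 2 = 1) (k : Fin (D - 1)) :
    ∑ i, ‖yVec s k i‖ ^ 2 = 1 := by
  rw [← overlap_one_proj, overlap_yVec isHermitian_one hs]
  simp [one_apply, lo_ne_hi]

lemma hi_fstEdge_ne_hi_sndEdge (k : Fin (D - 2)) : hi (fstEdge k) ≠ hi (sndEdge k) :=
  lo_sndEdge k ▸ lo_ne_hi (sndEdge k)

lemma sum_norm_sq_xxVec (k : Fin (D - 2)) : ∑ i, ‖xxVec k i‖ ^ 2 = 1 := by
  rw [← overlap_one_proj, overlap_xxVec isHermitian_one]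
  norm_num [one_apply, lo_ne_hi, hi_fstEdge_ne_hi_sndEdge, lo_ne_hi_sndEdge]

lemma sum_norm_sq_yyVec {s s' : ℝ} (hs : s ^ 2 = 1) (hs' : s' ^ 2 = 1) (k : Fin (D - 2)) :
    ∑ i, ‖yyVec s s' k i‖ ^ 2 = 1 := by
  rw [← overlap_one_proj, overlap_yyVec isHermitian_one hs hs']
  norm_num [one_apply, lo_ne_hi, hi_fstEdge_ne_hi_sndEdge, lo_ne_hi_sndEdge]

lemma isPureState_refState {ψ : Fin M → Op D} (hψ : ∀ j, IsPureState (ψ j)) (a : Label M D) :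
    IsPureState (refState ψ a) := by
  cases a with
  | psi j => exact hψ j
  | Z k => exact ⟨_, sum_norm_sq_single k, refState_Z ψ k⟩
  | X k => exact ⟨_, sum_norm_sq_xVec k, refState_X ψ k⟩
  | Y k => exact ⟨_, sum_norm_sq_yVec (one_pow 2) k, refState_Y ψ k⟩
  | XX k => exact ⟨_, sum_norm_sq_xxVec k, refState_XX ψ k⟩
  | YY k => exact ⟨_, sum_norm_sq_yyVec (one_pow 2) (one_pow 2) k, refState_YY ψ k⟩

lemma IsPureState.isState {ρ : Op D} (h : IsPureState ρ) : IsState ρ := by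
  obtain ⟨v, hv, rfl⟩ := h
  exact isState_proj hv

lemma IsPureState.overlap_self {ρ : Op D} (h : IsPureState ρ) : overlap ρ ρ = 1 := by
  obtain ⟨v, hv, rfl⟩ := h
  rw [overlap_proj_proj, star_dotProduct_self, hv]; simp

lemma proj_apply (v : Fin D → ℂ) (i j : Fin D) : proj v i j = v i * star (v j) := by
  simp [proj, vecMulVec_apply]

lemma xVec_lo (k : Fin (D - 1)) : xVec k (lo k) = ((1 / √2 : ℝ) : ℂ) := by
  simp [xVec, threeLevel, lo_ne_hi]

lemma xVec_hi (k : Fin (D - 1)) : xVec k (hi k) = ((1 / √2 : ℝ) : ℂ) := by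
  simp [xVec, threeLevel, (lo_ne_hi k).symm]

lemma yVec_lo (s : ℝ) (k : Fin (D - 1)) : yVec s k (lo k) = ((1 / √2 : ℝ) : ℂ) := by
  simp [yVec, threeLevel, lo_ne_hi]

lemma yVec_hi (s : ℝ) (k : Fin (D - 1)) :
    yVec s k (hi k) = ((1 / √2 : ℝ) : ℂ) * (s * Complex.I) := by
  simp [yVec, threeLevel, (lo_ne_hi k).symm]

lemma xVec_of_ne {k : Fin (D - 1)} {i : Fin D} (h : i ≠ lo k) (h' : i ≠ hi k) :
    xVec k i = 0 := by
  simp [xVec, threeLevel, h, h']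

lemma yVec_of_ne (s : ℝ) {k : Fin (D - 1)} {i : Fin D} (h : i ≠ lo k) (h' : i ≠ hi k) :
    yVec s k i = 0 := by
  simp [yVec, threeLevel, h, h']

lemma xxVec_apply (k : Fin (D - 2)) : xxVec k (lo (fstEdge k)) = ((1 / √3 : ℝ) : ℂ) ∧
    xxVec k (hi (fstEdge k)) = ((1 / √3 : ℝ) : ℂ) ∧
    xxVec k (hi (sndEdge k)) = ((1 / √3 : ℝ) : ℂ) := by
  have h1 := lo_ne_hi (fstEdge k)
  have h2 := lo_ne_hi_sndEdge k
  have h3 := hi_fstEdge_ne_hi_sndEdge k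
  simp [xxVec, threeLevel, h1, h2, h3, h1.symm, h2.symm, h3.symm]

lemma yyVec_apply (s s' : ℝ) (k : Fin (D - 2)) :
    yyVec s s' k (lo (fstEdge k)) = ((1 / √3 : ℝ) : ℂ) * (s * Complex.I) ∧
    yyVec s s' k (hi (fstEdge k)) = ((1 / √3 : ℝ) : ℂ) ∧
    yyVec s s' k (hi (sndEdge k)) = ((1 / √3 : ℝ) : ℂ) * (s' * Complex.I) := by
  have h1 := lo_ne_hi (fstEdge k)
  have h2 := lo_ne_hi_sndEdge k
  have h3 := hi_fstEdge_ne_hi_sndEdge k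
  simp [yyVec, threeLevel, h1, h2, h3, h1.symm, h2.symm, h3.symm]

lemma overlap_xVec_single (k : Fin (D - 1)) :
    overlap (proj (xVec k)) (proj (Pi.single (lo k) 1)) = 1 / 2 ∧
    overlap (proj (xVec k)) (proj (Pi.single (hi k) 1)) = 1 / 2 ∧
    ∀ i, i ≠ lo k → i ≠ hi k → overlap (proj (xVec k)) (proj (Pi.single i 1)) = 0 := by
  have h := inv_sqrt_two_sq
  refine ⟨?_, ?_, fun i h1 h2 => ?_⟩ <;> rw [overlap_single, proj_apply]
  · rw [xVec_lo]; generalize 1 / √2 = c at h; simp; linear_combination h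
  · rw [xVec_hi]; generalize 1 / √2 = c at h; simp; linear_combination h
  · rw [xVec_of_ne h1 h2]; simp

lemma overlap_yVec_single {s : ℝ} (hs : s ^ 2 = 1) (k : Fin (D - 1)) :
    overlap (proj (yVec s k)) (proj (Pi.single (lo k) 1)) = 1 / 2 ∧
    overlap (proj (yVec s k)) (proj (Pi.single (hi k) 1)) = 1 / 2 ∧
    ∀ i, i ≠ lo k → i ≠ hi k → overlap (proj (yVec s k)) (proj (Pi.single i 1)) = 0 := by
  have h := inv_sqrt_two_sq
  refine ⟨?_, ?_, fun i h1 h2 => ?_⟩ <;> rw [overlap_single, proj_apply]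
  · rw [yVec_lo]; generalize 1 / √2 = c at h; simp; linear_combination h
  · rw [yVec_hi]; generalize 1 / √2 = c at h; simp; linear_combination h + c ^ 2 * hs
  · rw [yVec_of_ne s h1 h2]; simp

lemma overlap_yVec_xVec {s : ℝ} (hs : s ^ 2 = 1) (k : Fin (D - 1)) :
    overlap (proj (yVec s k)) (proj (xVec k)) = 1 / 2 := by
  have h := inv_sqrt_two_sq
  rw [overlap_xVec (posSemidef_proj _).1]
  simp only [proj_apply, yVec_lo, yVec_hi]
  generalize 1 / √2 = c at h
  simp
  linear_combination h + c ^ 2 / 2 * hs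

lemma overlap_xxVec_single (k : Fin (D - 2)) :
    overlap (proj (xxVec k)) (proj (Pi.single (hi (fstEdge k)) 1)) = 1 / 3 := by
  have h := inv_sqrt_three_sq
  rw [overlap_single, proj_apply, (xxVec_apply k).2.1]
  generalize 1 / √3 = c at h; simp; linear_combination h

lemma overlap_xxVec_xVec (k : Fin (D - 2)) :
    overlap (proj (xxVec k)) (proj (xVec (fstEdge k))) = 2 / 3 ∧
    overlap (proj (xxVec k)) (proj (xVec (sndEdge k))) = 2 / 3 := by
  have h := inv_sqrt_three_sq
  obtain ⟨h1, h2, h3⟩ := xxVec_apply k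
  constructor <;>
  · rw [overlap_xVec (posSemidef_proj _).1]
    simp only [proj_apply, lo_sndEdge, h1, h2, h3]
    generalize 1 / √3 = c at h
    simp
    linear_combination 2 * h

lemma overlap_yyVec_single (k : Fin (D - 2)) :
    overlap (proj (yyVec 1 1 k)) (proj (Pi.single (lo (fstEdge k)) 1)) = 1 / 3 ∧
    overlap (proj (yyVec 1 1 k)) (proj (Pi.single (hi (fstEdge k)) 1)) = 1 / 3 ∧
    overlap (proj (yyVec 1 1 k)) (proj (Pi.single (hi (sndEdge k)) 1)) = 1 / 3 := by
  have h := inv_sqrt_three_sq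
  obtain ⟨h1, h2, h3⟩ := yyVec_apply 1 1 k
  refine ⟨?_, ?_, ?_⟩ <;>
  · rw [overlap_single]
    simp only [proj_apply, h1, h2, h3]
    generalize 1 / √3 = c at h
    simp
    linear_combination h

lemma overlap_yyVec_yVec (k : Fin (D - 2)) :
    overlap (proj (yyVec 1 1 k)) (proj (yVec 1 (fstEdge k))) = 0 ∧
    overlap (proj (yyVec 1 1 k)) (proj (yVec 1 (sndEdge k))) = 2 / 3 := by
  have h := inv_sqrt_three_sq
  obtain ⟨h1, h2, h3⟩ := yyVec_apply 1 1 k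
  constructor
  · rw [overlap_yVec (posSemidef_proj _).1 (one_pow 2)]
    simp only [proj_apply, h1, h2]
    generalize 1 / √3 = c at h
    simp
  · rw [overlap_yVec (posSemidef_proj _).1 (one_pow 2)]
    simp only [proj_apply, lo_sndEdge, h2, h3]
    generalize 1 / √3 = c at h
    simp
    linear_combination 2 * h

lemma overlap_yyVec_xxVec {s s' : ℝ} (hs : s ^ 2 = 1) (hs' : s' ^ 2 = 1) (k : Fin (D - 2)) :
    overlap (proj (yyVec s s' k)) (proj (xxVec k)) = 1 / 3 + 2 / 9 * (s * s') := by
  have h := inv_sqrt_three_sq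
  obtain ⟨h1, h2, h3⟩ := yyVec_apply s s' k
  rw [overlap_xxVec (posSemidef_proj _).1]
  simp only [proj_apply, h1, h2, h3]
  generalize 1 / √3 = c at h
  simp
  linear_combination (1 + 2 / 3 * s * s') * h + c ^ 2 / 3 * hs + c ^ 2 / 3 * hs'

lemma ne_of_overlap_ne_one {ψ : Fin M → Op D} (hψ : ∀ j, IsPureState (ψ j)) {a b : Label M D}
    (h : overlap (refState ψ a) (refState ψ b) ≠ 1) : refState ψ a ≠ refState ψ b := by
  intro hab
  rw [hab, (isPureState_refState hψ b).overlap_self] at h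
  exact h rfl

/-! ### Families of states that imitate the ensemble -/

/-- The family `ρ` of states reproduces the overlaps of the reference ensemble up to `δo` and has
purity defect at most `δp`. -/
structure IsApprox (ψ : Fin M → Op D) (ρ : Label M D → Op D) (δp δo : ℝ) : Prop where
  pure : ∀ j, IsPureState (ψ j)
  state : ∀ a, IsState (ρ a)
  overlap_le : ∀ a b, refState ψ a ≠ refState ψ b →
    |overlap (ρ a) (ρ b) - overlap (refState ψ a) (refState ψ b)| ≤ δo
  purity : ∀ a, 1 - overlap (ρ a) (ρ a) ≤ δp

namespace IsApprox

variable {ψ : Fin M → Op D} {ρ : Label M D → Op D} {δp δo : ℝ}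

lemma ref (h : IsApprox ψ ρ δp δo) (a : Label M D) : IsState (refState ψ a) :=
  (isPureState_refState h.pure a).isState

lemma conj (h : IsApprox ψ ρ δp δo) {V : Op D} (hV : Vᴴ * V = 1) :
    IsApprox ψ (fun a => V * ρ a * Vᴴ) δp δo where
  pure := h.pure
  state a := (h.state a).conj hV
  overlap_le a b hab := by rw [overlap_conj_conj hV]; exact h.overlap_le a b hab
  purity a := by rw [overlap_conj_conj hV]; exact h.purity a

lemma cc (h : IsApprox ψ ρ δp δo) : IsApprox ψ (fun a => cc (ρ a)) δp δo where
  pure := h.pure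
  state a := (h.state a).cc
  overlap_le a b hab := by rw [overlap_cc_cc]; exact h.overlap_le a b hab
  purity a := by rw [overlap_cc_cc]; exact h.purity a

lemma overlap_sub_le (h : IsApprox ψ ρ δp δo) {a b : Label M D}
    (hab : overlap (refState ψ a) (refState ψ b) ≠ 1) :
    |overlap (ρ a) (ρ b) - overlap (refState ψ a) (refState ψ b)| ≤ δo :=
  h.overlap_le a b (ne_of_overlap_ne_one h.pure hab)

/-- If `ρ b` is close to the state `τ`, then the overlaps with `τ` are almost the reference
overlaps with `b`. -/
lemma overlap_near (h : IsApprox ψ ρ δp δo) {a b : Label M D} {τ : Op D} (hτ : IsState τ)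
    {ε : ℝ} (hε : traceNorm (ρ b - τ) ≤ ε) (hab : refState ψ a ≠ refState ψ b) :
    |overlap (ρ a) τ - overlap (refState ψ a) (refState ψ b)| ≤ ε / 2 + δo := by
  have h1 := h.overlap_le a b hab
  have h2 := abs_overlap_sub_le (h.state b) hτ (h.state a)
  rw [overlap_comm, overlap_comm τ] at h2
  rw [abs_le] at *
  constructor <;> linarith

lemma δp_nonneg (h : IsApprox ψ ρ δp δo) (a : Label M D) : 0 ≤ δp := by
  have h1 := overlap_nonneg (h.state a).1 (h.state a).one_sub
  rw [overlap_sub_right, overlap_one_right, (h.state a).2, Complex.one_re] at h1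
  linarith [h.purity a]

end IsApprox

/-! ### Alignment with the computational basis -/

/-- A family imitating the ensemble, in a basis in which the states `ρ (.Z k)` are close to the
computational basis. The last field bounds, for the leading eigenvector of each state, the weights
at those positions at which the reference state has none. -/
structure IsFramed (ψ : Fin M → Op D) (ρ : Label M D → Op D) (δp δo : ℝ) : Prop
    extends IsApprox ψ ρ δp δo where
  close_Z : ∀ k, traceNorm (ρ (.Z k) - refState ψ (.Z k)) ≤ deltaZ D δp δo
  leading : ∀ a, ∃ x : Fin D → ℂ, ∑ i, ‖x i‖ ^ 2 = 1 ∧ traceNorm (ρ a - proj x) ≤ 2 * δp ∧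
    ∀ k, overlap (refState ψ a) (refState ψ (.Z k)) = 0 →
      ‖x k‖ ^ 2 ≤ (D + 1) * deltaZ' δp δo

lemma traceNorm_proj_mulVec {V : Op D} (hV : Vᴴ * V = 1) (A : Op D) (x : Fin D → ℂ) :
    traceNorm (V * A * Vᴴ - proj (V *ᵥ x)) = traceNorm (A - proj x) := by
  rw [proj_mulVec_eq, traceNorm_conj_sub hV]

lemma sum_norm_sq_mulVec {V : Op D} (hV : Vᴴ * V = 1) (x : Fin D → ℂ) :
    ∑ i, ‖(V *ᵥ x) i‖ ^ 2 = ∑ i, ‖x i‖ ^ 2 := by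
  rw [sum_norm_sq_eq, proj_mulVec_eq, trace_mul_comm, ← Matrix.mul_assoc, hV, Matrix.one_mul,
    ← sum_norm_sq_eq]

lemma sum_norm_sq_single_sub (k : Fin D) (z : Fin D → ℂ) :
    ∑ i, ‖((Pi.single k 1 : Fin D → ℂ) - z) i‖ ^ 2 = ∑ i, ‖z i‖ ^ 2 + (1 - 2 * (z k).re) := by
  have : ∀ i, ‖((Pi.single k 1 : Fin D → ℂ) - z) i‖ ^ 2 =
      ‖z i‖ ^ 2 + if i = k then 1 - 2 * (z k).re else 0 := by
    intro i
    rcases eq_or_ne i k with rfl | hi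
    · simp [Complex.sq_norm, Complex.normSq_apply]; ring
    · simp [hi]
  simp_rw [this]
  rw [Finset.sum_add_distrib, Finset.sum_ite_eq' Finset.univ k]
  simp

/-- A unit vector almost orthogonal to a unit vector close to `|k⟩` has a small weight at `k`. -/
lemma norm_sq_apply_le {x z : Fin D → ℂ} {k : Fin D} {r ε η : ℝ} (hx : ∑ i, ‖x i‖ ^ 2 = 1)
    (hz : ∑ i, ‖z i‖ ^ 2 = 1) (hzk : z k = r) (hr : 1 - η ≤ r)
    (hε : overlap (proj z) (proj x) ≤ ε) : ‖x k‖ ^ 2 ≤ 2 * ε + 4 * η := by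
  have hsplit : x k = star z ⬝ᵥ x + star (Pi.single k 1 - z) ⬝ᵥ x := by
    rw [← add_dotProduct, ← star_add, add_sub_cancel, ← Pi.single_star, star_one,
      single_one_dotProduct]
  have h1 := overlap_proj_le_trace (posSemidef_proj (Pi.single k 1 - z)) x
  rw [← sum_norm_sq_eq, hx, mul_one, sum_norm_sq_single_sub, hz, hzk, Complex.ofReal_re,
    overlap_proj_proj] at h1
  rw [overlap_proj_proj] at hε
  have h2 := norm_add_le (star z ⬝ᵥ x) (star (Pi.single k 1 - z) ⬝ᵥ x)
  rw [← hsplit] at h2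
  nlinarith [norm_nonneg (x k), norm_nonneg (star z ⬝ᵥ x),
    norm_nonneg (star (Pi.single k 1 - z) ⬝ᵥ x),
    sq_nonneg (‖star z ⬝ᵥ x‖ - ‖star (Pi.single k 1 - z) ⬝ᵥ x‖)]

lemma overlap_proj_proj_le {ρ σ : Op D} (hρ : IsState ρ) (hσ : IsState σ) {x y : Fin D → ℂ}
    (hx : ∑ i, ‖x i‖ ^ 2 = 1) (hy : ∑ i, ‖y i‖ ^ 2 = 1) {δ ε : ℝ}
    (hxρ : traceNorm (ρ - proj x) ≤ 2 * δ) (hyσ : traceNorm (σ - proj y) ≤ 2 * δ)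
    (h : |overlap ρ σ - 0| ≤ ε) : overlap (proj x) (proj y) ≤ 2 * δ + ε := by
  have h1 := abs_overlap_sub_le hρ (isState_proj hx) hσ
  have h2 := abs_overlap_sub_le hσ (isState_proj hy) (isState_proj hx)
  rw [overlap_comm σ, overlap_comm (proj y)] at h2
  rw [abs_le] at *
  linarith

/-- The leading eigenvectors of the states `ρ (.Z k)` are almost orthonormal; symmetric
orthogonalization provides the change of basis. -/
lemma IsApprox.exists_framed {ψ : Fin M → Op D} {ρ : Label M D → Op D} {δp δo : ℝ}
    (h : IsApprox ψ ρ δp δo) (hD : 3 ≤ D) (h1 : deltaZ' δp δo < 1 / ((D : ℝ) - 1) ^ 2)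
    (h2 : (D : ℝ) * ((D - 1) * deltaZ' δp δo) ≤ 9 / 16) :
    ∃ V : Op D, Vᴴ * V = 1 ∧ V * Vᴴ = 1 ∧ IsFramed ψ (fun a => V * ρ a * Vᴴ) δp δo := by
  have hD' : (3 : ℝ) ≤ D := by exact_mod_cast hD
  choose x hx hxρ using fun a => exists_pure_approx (h.state a) (h.purity a)
  have horth : ∀ a k, overlap (refState ψ a) (refState ψ (.Z k)) = 0 →
      overlap (proj (x a)) (proj (x (.Z k))) ≤ deltaZ' δp δo := by
    intro a k hak
    have := h.overlap_sub_le (a := a) (b := .Z k) (by rw [hak]; norm_num)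
    rw [hak] at this
    exact overlap_proj_proj_le (h.state _) (h.state _) (hx _) (hx _) (hxρ _) (hxρ _) this
  have hZZ : ∀ j k : Fin D, j ≠ k →
      overlap (refState ψ (.Z j)) (refState ψ (.Z k)) = 0 := by
    intro j k hjk
    rw [refState_Z, refState_Z, overlap_single, proj_apply]
    simp [hjk]
  have hδ' : 0 ≤ deltaZ' δp δo := by
    refine le_trans ?_ (horth (.Z ⟨0, by omega⟩) ⟨1, by omega⟩ (hZZ _ _ (by simp)))
    rw [overlap_proj_proj]; positivity
  obtain ⟨V, hV, hV', hVr⟩ := exists_unitary_of_almost_orthonormal (z := fun k => x (.Z k))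
    (ε := deltaZ' δp δo) (fun k => hx _)
    (fun j k hjk => by rw [← overlap_proj_proj]; exact horth _ _ (hZZ j k hjk)) h2
  refine ⟨V, hV, hV', { toIsApprox := h.conj hV, close_Z := ?_, leading := ?_ }⟩
  · intro k
    obtain ⟨r, hr, hr'⟩ := hVr k
    have hs : ∑ i, ‖(V *ᵥ x (.Z k)) i‖ ^ 2 = 1 := by rw [sum_norm_sq_mulVec hV, hx]
    refine (traceNorm_sub_le ((h.state _).conj hV) (isState_proj hs) (h.ref _)).trans ?_
    rw [traceNorm_proj_mulVec hV, deltaZ]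
    refine add_le_add (hxρ _) ?_
    rw [refState_Z]
    refine (traceNorm_sub_proj_le (isState_proj hs) (sum_norm_sq_single k)).trans ?_
    refine mul_le_mul_of_nonneg_left (Real.sqrt_le_sqrt ?_) zero_le_two
    rw [overlap_single, proj_apply, hr, RCLike.star_def, Complex.conj_ofReal,
      ← Complex.ofReal_mul, Complex.ofReal_re, ← sq]
    have ht : deltaZ' δp δo * ((D : ℝ) - 1) ^ 2 < 1 := by
      rwa [lt_div_iff₀ (by nlinarith)] at h1
    -- Here `D ≥ 3` gives `(D - 1) / 4 ≤ (D - 1) ^ 2 / 8`.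
    have hle : 1 - deltaZ' δp δo / 8 * ((D : ℝ) - 1) ^ 2 ≤ r := by
      refine le_trans ?_ hr'
      nlinarith [mul_nonneg hδ' (mul_nonneg (sub_nonneg.2 hD') (show (0 : ℝ) ≤ D - 1 by linarith))]
    have := pow_le_pow_left₀ (by linarith) hle 2
    linarith
  · intro a
    have hs : ∀ a, ∑ i, ‖(V *ᵥ x a) i‖ ^ 2 = 1 := fun a => by rw [sum_norm_sq_mulVec hV, hx]
    refine ⟨V *ᵥ x a, hs a, by rw [traceNorm_proj_mulVec hV]; exact hxρ a, fun k hk => ?_⟩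
    obtain ⟨r, hr, hr'⟩ := hVr k
    have ho : overlap (proj (V *ᵥ x (.Z k))) (proj (V *ᵥ x a)) ≤ deltaZ' δp δo := by
      rw [proj_mulVec_eq, proj_mulVec_eq, overlap_conj_conj hV, overlap_comm]
      exact horth a k hk
    have := norm_sq_apply_le (hs a) (hs _) hr (η := (D - 1) * deltaZ' δp δo / 4)
      (by linarith) ho
    linarith

variable {ψ : Fin M → Op D} {ρ : Label M D → Op D} {δp δo : ℝ}

/-! ### Fixing the phases by the states `X` -/

/-- The numerical smallness of the errors on which the argument rests. -/
structure IsSmall (D : ℕ) (δp δo : ℝ) : Prop where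
  δp_nonneg : 0 ≤ δp
  δo_nonneg : 0 ≤ δo
  deltaX'_le : deltaX' D δp δo ≤ 1 / 1500
  sq_mul_deltaZ'_le : ((D : ℝ) - 1) ^ 2 * deltaZ' δp δo ≤ 8 * deltaX' D δp δo ^ 2

lemma deltaZ_nonneg (D : ℕ) {δp : ℝ} (h : 0 ≤ δp) (δo : ℝ) : 0 ≤ deltaZ D δp δo := by
  unfold deltaZ; positivity

lemma diagonal_conjTranspose_mul {u : Fin D → ℂ} (hu : ∀ i, ‖u i‖ = 1) :
    (diagonal u)ᴴ * diagonal u = 1 := by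
  rw [diagonal_conjTranspose, diagonal_mul_diagonal, ← diagonal_one]
  congr 1; ext i
  simp [Complex.conj_mul', hu]

lemma diagonal_conj_proj_single {u : Fin D → ℂ} (hu : ∀ i, ‖u i‖ = 1) (k : Fin D) :
    diagonal u * proj (Pi.single k 1) * (diagonal u)ᴴ = proj (Pi.single k 1) := by
  ext i j
  rw [diagonal_conjTranspose, mul_diagonal, diagonal_mul, proj_apply]
  rcases eq_or_ne i k with rfl | hi
  · rcases eq_or_ne j i with rfl | hj
    · simp [Complex.mul_conj', hu]
    · simp [hj]
  · simp [hi]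

namespace IsFramed

lemma conj_diagonal (h : IsFramed ψ ρ δp δo) {u : Fin D → ℂ} (hu : ∀ i, ‖u i‖ = 1) :
    IsFramed ψ (fun a => diagonal u * ρ a * (diagonal u)ᴴ) δp δo where
  toIsApprox := h.toIsApprox.conj (diagonal_conjTranspose_mul hu)
  close_Z k := by
    have := h.close_Z k
    rw [refState_Z] at this ⊢
    rwa [← diagonal_conj_proj_single hu, traceNorm_conj_sub (diagonal_conjTranspose_mul hu)]
  leading a := by
    obtain ⟨x, hx, hxρ, hx0⟩ := h.leading a
    refine ⟨diagonal u *ᵥ x, ?_, ?_, fun k hk => ?_⟩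
    · rw [sum_norm_sq_mulVec (diagonal_conjTranspose_mul hu), hx]
    · rwa [traceNorm_proj_mulVec (diagonal_conjTranspose_mul hu)]
    · rw [mulVec_diagonal, norm_mul, hu, one_mul]
      exact hx0 k hk

/-- The leading eigenvector of a state that imitates an equal superposition of two basis states is
almost such a superposition. The total weight is controlled to second order in `deltaX'`. -/
lemma two_level (h : IsFramed ψ ρ δp δo) (hs : IsSmall D δp δo) (hD : 3 ≤ D) {a : Label M D}
    {k : Fin (D - 1)} (hlo : overlap (refState ψ a) (refState ψ (.Z (lo k))) = 1 / 2)
    (hhi : overlap (refState ψ a) (refState ψ (.Z (hi k))) = 1 / 2)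
    (h0 : ∀ i, i ≠ lo k → i ≠ hi k → overlap (refState ψ a) (refState ψ (.Z i)) = 0) :
    ∃ x : Fin D → ℂ, ∑ i, ‖x i‖ ^ 2 = 1 ∧ traceNorm (ρ a - proj x) ≤ 2 * δp ∧
      |‖x (lo k)‖ ^ 2 - 1 / 2| ≤ deltaX' D δp δo ∧ |‖x (hi k)‖ ^ 2 - 1 / 2| ≤ deltaX' D δp δo ∧
      1 - 16 * deltaX' D δp δo ^ 2 ≤ ‖x (lo k)‖ ^ 2 + ‖x (hi k)‖ ^ 2 ∧
      ‖x (lo k)‖ ^ 2 + ‖x (hi k)‖ ^ 2 ≤ 1 := by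
  obtain ⟨x, hx, hxρ, hx0⟩ := h.leading a
  have hw : ∀ i, overlap (refState ψ a) (refState ψ (.Z i)) = 1 / 2 →
      |‖x i‖ ^ 2 - 1 / 2| ≤ deltaX' D δp δo := by
    intro i hi
    have h1 := h.overlap_near (a := a) (h.ref (.Z i)) (h.close_Z i)
      (ne_of_overlap_ne_one h.pure (by rw [hi]; norm_num))
    have h2 := abs_overlap_sub_le (h.state a) (isState_proj hx) (h.ref (.Z i))
    rw [hi] at h1
    have h3 : overlap (proj x) (refState ψ (.Z i)) = ‖x i‖ ^ 2 := by
      rw [refState_Z, overlap_single, proj_apply, RCLike.star_def, Complex.mul_conj',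
        ← Complex.ofReal_pow, Complex.ofReal_re]
    rw [h3] at h2
    rw [deltaX']
    rw [abs_le] at *
    constructor <;> linarith
  have hsum : ∑ i, ‖x i‖ ^ 2 = ‖x (lo k)‖ ^ 2 + ‖x (hi k)‖ ^ 2 +
      ∑ i ∈ (Finset.univ.erase (lo k)).erase (hi k), ‖x i‖ ^ 2 := by
    rw [add_assoc, Finset.add_sum_erase _ (fun i => ‖x i‖ ^ 2) (by simp [(lo_ne_hi k).symm]),
      Finset.add_sum_erase _ (fun i => ‖x i‖ ^ 2) (Finset.mem_univ _)]
  have hnn : 0 ≤ ∑ i ∈ (Finset.univ.erase (lo k)).erase (hi k), ‖x i‖ ^ 2 :=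
    Finset.sum_nonneg fun i _ => sq_nonneg _
  have hout : ∑ i ∈ (Finset.univ.erase (lo k)).erase (hi k), ‖x i‖ ^ 2 ≤
      ((D : ℝ) - 2) * ((D + 1) * deltaZ' δp δo) := by
    have := Finset.sum_le_card_nsmul ((Finset.univ.erase (lo k)).erase (hi k))
      (fun i => ‖x i‖ ^ 2) ((D + 1) * deltaZ' δp δo) (fun i hi => by
        rw [Finset.mem_erase, Finset.mem_erase] at hi
        exact hx0 i (h0 i hi.2.1 hi.1))
    rw [Finset.card_erase_of_mem (by simp [(lo_ne_hi k).symm]),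
      Finset.card_erase_of_mem (Finset.mem_univ _), Finset.card_univ, Fintype.card_fin,
      nsmul_eq_mul, Nat.sub_sub, Nat.cast_sub (by omega)] at this
    exact_mod_cast this
  have hδ : 0 ≤ deltaZ' δp δo := by
    have := hs.δp_nonneg; have := hs.δo_nonneg; unfold deltaZ'; positivity
  have hD' : (3 : ℝ) ≤ D := by exact_mod_cast hD
  refine ⟨x, hx, hxρ, hw _ hlo, hw _ hhi, ?_, by linarith⟩
  have := hs.sq_mul_deltaZ'_le
  nlinarith [mul_nonneg hδ (sq_nonneg ((D : ℝ) - 5 / 2))]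

end IsFramed

/-- Phases `u` that turn given complex numbers `c k` on the edges of a path into their absolute
values; they are found by walking along the path. -/
lemma exists_phases (c : Fin (D - 1) → ℂ) :
    ∃ u : Fin D → ℂ, (∀ i, ‖u i‖ = 1) ∧ ∀ k, u (lo k) * star (u (hi k)) * c k = ‖c k‖ := by
  set w : ℕ → ℂ := fun n =>
    if h : n < D - 1 then Complex.exp ((c ⟨n, h⟩).arg * Complex.I) else 1 with hw
  have hw1 : ∀ n, ‖w n‖ = 1 := by
    intro n
    by_cases h : n < D - 1
    · simp only [hw, dif_pos h, Complex.norm_exp_ofReal_mul_I]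
    · simp [hw, dif_neg h]
  have hu : ∀ n, ‖∏ m ∈ Finset.range n, w m‖ = 1 := fun n => by simp [norm_prod, hw1]
  refine ⟨fun i => ∏ m ∈ Finset.range i, w m, fun i => hu i, fun k => ?_⟩
  have hk : w k = Complex.exp ((c k).arg * Complex.I) := by simp [hw]
  have h1 : c k = ‖c k‖ * w k := by rw [hk, Complex.norm_mul_exp_arg_mul_I]
  simp only [lo, hi, Finset.prod_range_succ, star_mul']
  have e1 := Complex.mul_conj' (∏ m ∈ Finset.range (k : ℕ), w m)
  have e2 := Complex.conj_mul' (w k)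
  rw [hu] at e1
  rw [hw1] at e2
  simp only [RCLike.star_def]
  generalize (∏ m ∈ Finset.range (k : ℕ), w m) = p at *
  calc _ = (p * (starRingEnd ℂ) p) * ((starRingEnd ℂ) (w k) * c k) := by ring
    _ = _ := by
      rw [e1]
      conv_lhs => rw [h1]
      rw [mul_left_comm _ (‖c k‖ : ℂ), e2]
      simp

/-- A framed family in which the states `ρ (.X k)` are close to the reference states. The field
`close_X'` improves the bound `deltaX`, of order `√deltaX'`, to one linear in `deltaX'`. -/
structure IsXAligned (ψ : Fin M → Op D) (ρ : Label M D → Op D) (δp δo : ℝ) : Prop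
    extends IsFramed ψ ρ δp δo where
  close_X : ∀ k, traceNorm (ρ (.X k) - refState ψ (.X k)) ≤ deltaX D δp δo
  close_X' : ∀ k, traceNorm (ρ (.X k) - refState ψ (.X k)) ≤ 11 * deltaX' D δp δo

lemma deltaX'_nonneg (hs : IsSmall D δp δo) : 0 ≤ deltaX' D δp δo := by
  have h1 := hs.δp_nonneg
  have h2 := hs.δo_nonneg
  have := deltaZ_nonneg D h1 δo
  unfold deltaX'; positivity

lemma δp_le_deltaX' (hs : IsSmall D δp δo) : δp + δo ≤ deltaX' D δp δo := by
  have := deltaZ_nonneg D hs.δp_nonneg δo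
  unfold deltaX'; linarith

/-- A diagonal unitary makes the coherences of the leading eigenvectors of the states `ρ (.X k)`
positive. -/
lemma IsFramed.exists_xAligned (h : IsFramed ψ ρ δp δo) (hs : IsSmall D δp δo) (hD : 3 ≤ D) :
    ∃ u : Fin D → ℂ, (∀ i, ‖u i‖ = 1) ∧
      IsXAligned ψ (fun a => diagonal u * ρ a * (diagonal u)ᴴ) δp δo := by
  have hX : ∀ k, ∃ x : Fin D → ℂ, ∑ i, ‖x i‖ ^ 2 = 1 ∧ traceNorm (ρ (.X k) - proj x) ≤ 2 * δp ∧
      |‖x (lo k)‖ ^ 2 - 1 / 2| ≤ deltaX' D δp δo ∧ |‖x (hi k)‖ ^ 2 - 1 / 2| ≤ deltaX' D δp δo ∧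
      1 - 16 * deltaX' D δp δo ^ 2 ≤ ‖x (lo k)‖ ^ 2 + ‖x (hi k)‖ ^ 2 ∧
      ‖x (lo k)‖ ^ 2 + ‖x (hi k)‖ ^ 2 ≤ 1 := by
    intro k
    obtain ⟨h1, h2, h3⟩ := overlap_xVec_single k
    apply h.two_level hs hD
    · rwa [refState_X, refState_Z]
    · rwa [refState_X, refState_Z]
    · intro i; rw [refState_X, refState_Z]; exact h3 i
  choose x hx hxρ hlo hhi hS hS1 using hX
  obtain ⟨u, hu, huc⟩ := exists_phases (fun k => x k (lo k) * star (x k (hi k)))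
  have he := deltaX'_nonneg hs
  have he' := hs.deltaX'_le
  -- The fidelity of the rotated eigenvector with `|X_k⟩`, in terms of the two absolute values.
  have hfid : ∀ k, overlap (proj (diagonal u *ᵥ x k)) (proj (xVec k)) =
      (‖x k (lo k)‖ ^ 2 + ‖x k (hi k)‖ ^ 2) / 2 + ‖x k (lo k)‖ * ‖x k (hi k)‖ := by
    intro k
    have h1 := huc k
    rw [norm_mul, norm_star] at h1
    rw [overlap_xVec (posSemidef_proj _).1]
    simp only [proj_apply, mulVec_diagonal, RCLike.star_def, Complex.mul_conj', norm_mul, hu,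
      one_mul, ← Complex.ofReal_pow, Complex.ofReal_re]
    congr 1
    rw [← Complex.ofReal_re (‖x k (lo k)‖ * ‖x k (hi k)‖), ← h1]
    congr 1
    simp only [RCLike.star_def, map_mul]
    ring
  have hclose : ∀ k (ε : ℝ), 1 - ε ≤ overlap (proj (diagonal u *ᵥ x k)) (proj (xVec k)) →
      traceNorm (diagonal u * ρ (.X k) * (diagonal u)ᴴ - refState ψ (.X k)) ≤
        2 * √ε + 2 * δp := by
    intro k ε hε
    have hU := diagonal_conjTranspose_mul hu
    have hy : ∑ i, ‖(diagonal u *ᵥ x k) i‖ ^ 2 = 1 := by rw [sum_norm_sq_mulVec hU, hx]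
    have h1 := traceNorm_sub_le ((h.state (.X k)).conj hU) (isState_proj hy) (h.ref (.X k))
    rw [traceNorm_proj_mulVec hU] at h1
    have h2 := traceNorm_sub_proj_le (isState_proj hy) (sum_norm_sq_xVec k)
    rw [← refState_X ψ] at h2 hε
    have h3 : √(1 - overlap (proj (diagonal u *ᵥ x k)) (refState ψ (.X k))) ≤ √ε :=
      Real.sqrt_le_sqrt (by linarith)
    linarith [hxρ k]
  refine ⟨u, hu, ⟨h.conj_diagonal hu, fun k => ?_, fun k => ?_⟩⟩
  · refine (hclose k (2 * deltaX' D δp δo) ?_).trans (le_of_eq ?_)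
    · rw [hfid]
      have h1 := (abs_le.1 (hlo k)).1
      have h2 := (abs_le.1 (hhi k)).1
      have h3 : 1 / 2 - deltaX' D δp δo ≤ ‖x k (lo k)‖ * ‖x k (hi k)‖ := by
        refine le_of_abs_le (abs_le_of_sq_le_sq ?_ (by positivity))
        rw [mul_pow, sq]
        exact mul_le_mul (by linarith) (by linarith) (by linarith) (by positivity)
      linarith
    · rw [deltaX, Real.sqrt_mul zero_le_two]; ring
  · refine (hclose k (20 * deltaX' D δp δo ^ 2) ?_).trans ?_
    · rw [hfid]
      have h1 := abs_le.1 (hlo k)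
      have h2 := abs_le.1 (hhi k)
      have h3 := hS k
      set e := deltaX' D δp δo
      have ha := norm_nonneg (x k (lo k))
      have hb := norm_nonneg (x k (hi k))
      set a := ‖x k (lo k)‖
      set b := ‖x k (hi k)‖
      have h4 : (a ^ 2 - b ^ 2) ^ 2 ≤ 4 * e ^ 2 := by nlinarith
      have h5 : 1 / 2 ≤ (a + b) ^ 2 := by nlinarith [mul_nonneg ha hb]
      have h6 : (a - b) ^ 2 * (a + b) ^ 2 ≤ 4 * e ^ 2 := by
        refine le_trans (le_of_eq ?_) h4
        ring
      have h7 : (a - b) ^ 2 ≤ 8 * e ^ 2 := by nlinarith [sq_nonneg (a - b)]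
      nlinarith
    · have : √(20 * deltaX' D δp δo ^ 2) ≤ 9 / 2 * deltaX' D δp δo :=
        Real.sqrt_le_iff.2 ⟨by positivity, by nlinarith⟩
      linarith [δp_le_deltaX' hs, hs.δo_nonneg]

/-! ### The states `Y` up to complex conjugation -/

/-- The fidelity of a two-level vector with populations `p`, `q` and coherence `R + i I` with the
nearer of `|Y_k⟩` and its conjugate is `(p + q) / 2 + |I|`; it is bounded below by `fRoot`. -/
lemma fRoot_le {p q R I r ε : ℝ} (hRI : R ^ 2 + I ^ 2 = p * q) (hR : |R| ≤ r)
    (hp : |p - 1 / 2| ≤ ε) (hq : |q - 1 / 2| ≤ ε) (hε : ε ≤ 1 / 2) :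
    fRoot (r ^ 2 + ε ^ 2) (1 - 2 * ε) ≤ (p + q) / 2 + |I| := by
  rw [abs_le] at hp hq
  have hR2 : R ^ 2 ≤ r ^ 2 := sq_le_sq' (by linarith [(abs_le.1 hR).1]) (abs_le.1 hR).2
  have hpq : (p - q) ^ 2 ≤ (2 * ε) ^ 2 := sq_le_sq' (by linarith) (by linarith)
  have hS : (1 - 2 * ε) ^ 2 ≤ (p + q) ^ 2 := pow_le_pow_left₀ (by linarith) (by linarith) 2
  have hI : |I| ^ 2 = I ^ 2 := sq_abs I
  have : √((1 - 2 * ε) ^ 2 - 4 * (r ^ 2 + ε ^ 2)) ≤ 2 * |I| :=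
    Real.sqrt_le_iff.2 ⟨by positivity, by nlinarith⟩
  rw [fRoot]
  linarith

/-- The fidelity bounded in `fRoot_le` is `1` up to second order in `e`. -/
lemma one_sub_le_of_abs_le {p q R I e : ℝ} (hRI : R ^ 2 + I ^ 2 = p * q) (hR : |R| ≤ 7 * e)
    (hp : |p - 1 / 2| ≤ e) (hq : |q - 1 / 2| ≤ e) (hS : 1 - 16 * e ^ 2 ≤ p + q)
    (he : e ≤ 1 / 1500) : 1 - 121 * e ^ 2 ≤ (p + q) / 2 + |I| := by
  have he0 : 0 ≤ e := (abs_nonneg _).trans hp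
  rw [abs_le] at hp hq
  have hR2 : R ^ 2 ≤ (7 * e) ^ 2 := sq_le_sq' (by linarith [(abs_le.1 hR).1]) (abs_le.1 hR).2
  have hpq : (p - q) ^ 2 ≤ (2 * e) ^ 2 := sq_le_sq' (by linarith) (by linarith)
  have he2 : e ^ 2 ≤ 1 / 1500 ^ 2 := by
    rw [← _root_.one_div_pow]; exact pow_le_pow_left₀ he0 he 2
  have : (p + q) / 2 - 105 * e ^ 2 ≤ |I| := by
    refine le_of_abs_le (abs_le_of_sq_le_sq ?_ (abs_nonneg I))
    rw [sq_abs]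
    nlinarith [mul_nonneg (sq_nonneg e) (show 0 ≤ p + q - 1 / 2 by linarith),
      mul_nonneg (sq_nonneg e) (sub_nonneg.2 he2)]
  linarith

/-- Each `ρ (.Y k)` is close to `|Y_k⟩` or to its complex conjugate. The first bound is `deltaY`,
the second one is linear in `deltaX'`. -/
lemma IsXAligned.exists_sign (h : IsXAligned ψ ρ δp δo) (hs : IsSmall D δp δo) (hD : 3 ≤ D)
    (k : Fin (D - 1)) : ∃ s : ℝ, (s = 1 ∨ s = -1) ∧
      traceNorm (ρ (.Y k) - proj (yVec s k)) ≤ deltaY D δp δo ∧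
      traceNorm (ρ (.Y k) - proj (yVec s k)) ≤ 24 * deltaX' D δp δo := by
  obtain ⟨h1, h2, h3⟩ := overlap_yVec_single (one_pow 2) k
  obtain ⟨y, hy, hyρ, hlo, hhi, hS, hS1⟩ := h.two_level (a := .Y k) (k := k) hs hD
    (by rwa [refState_Y, refState_Z]) (by rwa [refState_Y, refState_Z])
    (fun i => by rw [refState_Y, refState_Z]; exact h3 i)
  have he := deltaX'_nonneg hs
  have he' := hs.deltaX'_le
  have hyX := overlap_yVec_xVec (one_pow 2) k
  have hne : refState ψ (.Y k) ≠ refState ψ (.X k) :=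
    ne_of_overlap_ne_one h.pure (by rw [refState_X, refState_Y, hyX]; norm_num)
  have hn : ∀ i, (proj y i i).re = ‖y i‖ ^ 2 := fun i => by
    rw [proj_apply, RCLike.star_def, Complex.mul_conj', ← Complex.ofReal_pow, Complex.ofReal_re]
  have hRI : (proj y (lo k) (hi k)).re ^ 2 + (proj y (lo k) (hi k)).im ^ 2 =
      ‖y (lo k)‖ ^ 2 * ‖y (hi k)‖ ^ 2 := by
    rw [← mul_pow, ← norm_star (y (hi k)), ← norm_mul, ← proj_apply, Complex.sq_norm,
      Complex.normSq_apply]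
    ring
  have hR : ∀ ε, traceNorm (ρ (.X k) - refState ψ (.X k)) ≤ ε →
      |(‖y (lo k)‖ ^ 2 + ‖y (hi k)‖ ^ 2) / 2 + (proj y (lo k) (hi k)).re - 1 / 2| ≤
        ε / 2 + δo + δp := by
    intro ε hε
    have e1 := h.overlap_near (a := .Y k) (h.ref (.X k)) hε hne
    have e2 := abs_overlap_sub_le (h.state (.Y k)) (isState_proj hy) (h.ref (.X k))
    have e3 := overlap_xVec (posSemidef_proj y).1 k
    rw [hn, hn] at e3
    rw [refState_Y, refState_X, hyX] at e1
    rw [refState_X, e3] at e2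
    rw [abs_le] at *
    constructor <;> linarith
  -- The sign is chosen so that the imaginary part of the coherence counts positively.
  obtain ⟨s, hs1, hsI⟩ : ∃ s : ℝ, (s = 1 ∨ s = -1) ∧
      -(s * (proj y (lo k) (hi k)).im) = |(proj y (lo k) (hi k)).im| := by
    rcases le_total 0 (proj y (lo k) (hi k)).im with hI | hI
    · exact ⟨-1, Or.inr rfl, by rw [abs_of_nonneg hI]; ring⟩
    · exact ⟨1, Or.inl rfl, by rw [abs_of_nonpos hI]; ring⟩
  have hs2 : s ^ 2 = 1 := by rcases hs1 with rfl | rfl <;> norm_num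
  have hq := overlap_yVec (posSemidef_proj y).1 hs2 k
  rw [hn, hn, sub_eq_add_neg, hsI] at hq
  have hclose : ∀ ε, ε ≤ overlap (proj y) (proj (yVec s k)) →
      traceNorm (ρ (.Y k) - proj (yVec s k)) ≤ 2 * δp + 2 * √(1 - ε) := by
    intro ε hε
    have e1 := traceNorm_sub_le (h.state (.Y k)) (isState_proj hy)
      (isState_proj (sum_norm_sq_yVec hs2 k))
    have e2 := traceNorm_sub_proj_le (isState_proj hy) (sum_norm_sq_yVec hs2 k)
    have e3 : √(1 - overlap (proj y) (proj (yVec s k))) ≤ √(1 - ε) :=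
      Real.sqrt_le_sqrt (by linarith)
    linarith
  refine ⟨s, hs1, hclose _ ?_, (hclose (1 - 121 * deltaX' D δp δo ^ 2) ?_).trans ?_⟩
  · rw [hq]
    refine fRoot_le (r := (deltaX D δp δo + deltaZ D δp δo) / 2 + 2 * δp + 2 * δo) hRI ?_ hlo hhi
      (by rw [deltaX'] at he'; linarith)
    have e1 := hR _ (h.close_X k)
    rw [abs_le] at hlo hhi e1 ⊢
    rw [deltaX'] at hlo hhi
    constructor <;> linarith
  · rw [hq]
    refine one_sub_le_of_abs_le hRI ?_ hlo hhi hS he'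
    have e1 := hR _ (h.close_X' k)
    have e2 := δp_le_deltaX' hs
    have e3 : deltaX' D δp δo ^ 2 ≤ 1 / 1500 * deltaX' D δp δo := by nlinarith
    rw [abs_le] at e1 ⊢
    constructor <;> linarith
  · have e1 : 1 - (1 - 121 * deltaX' D δp δo ^ 2) = (11 * deltaX' D δp δo) ^ 2 := by ring
    rw [e1, Real.sqrt_sq (by positivity)]
    linarith [δp_le_deltaX' hs, hs.δo_nonneg]

/-- The state `ρ (.XX k)` is close to the reference state, by its parent Hamiltonian. -/
lemma IsXAligned.one_sub_overlap_XX_le (h : IsXAligned ψ ρ δp δo) (hs : IsSmall D δp δo)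
    (k : Fin (D - 2)) : 1 - overlap (ρ (.XX k)) (proj (xxVec k)) ≤ 28 * deltaX' D δp δo := by
  have hH := one_sub_overlap_xxVec_le (h.state (.XX k)) k
  have hz := overlap_xxVec_single k
  obtain ⟨hx1, hx2⟩ := overlap_xxVec_xVec k
  have e1 := h.overlap_near (a := .XX k) (h.ref _) (h.close_Z (hi (fstEdge k)))
    (ne_of_overlap_ne_one h.pure (by rw [refState_XX, refState_Z, hz]; norm_num))
  have e2 := h.overlap_near (a := .XX k) (h.ref _) (h.close_X' (fstEdge k))
    (ne_of_overlap_ne_one h.pure (by rw [refState_XX, refState_X, hx1]; norm_num))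
  have e3 := h.overlap_near (a := .XX k) (h.ref _) (h.close_X' (sndEdge k))
    (ne_of_overlap_ne_one h.pure (by rw [refState_XX, refState_X, hx2]; norm_num))
  rw [refState_XX, refState_Z, hz, abs_le] at e1
  rw [refState_XX, refState_X, hx1, abs_le] at e2
  rw [refState_XX, refState_X, hx2, abs_le] at e3
  have e4 := hs.δp_nonneg
  have e5 := δp_le_deltaX' hs
  have e6 : deltaX' D δp δo = deltaZ D δp δo / 2 + δp + δo := rfl
  linarith

/-- Bound on the distance of `ρ (.YY k)` from `yyVec`, given the distances of the two states
`ρ (.Y _)` on its edges from `yVec`. -/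
lemma IsFramed.one_sub_overlap_YY_le (h : IsFramed ψ ρ δp δo) (k : Fin (D - 2)) {s s' ε : ℝ}
    (hs : s ^ 2 = 1) (hs' : s' ^ 2 = 1)
    (h1 : traceNorm (ρ (.Y (fstEdge k)) - proj (yVec s (fstEdge k))) ≤ ε)
    (h2 : traceNorm (ρ (.Y (sndEdge k)) - proj (yVec s' (sndEdge k))) ≤ ε) :
    1 - overlap (ρ (.YY k)) (proj (yyVec s s' k)) ≤
      3 / 2 * deltaZ D δp δo + 2 * ε + 7 * δo := by
  have hH := one_sub_overlap_yyVec_le (h.state (.YY k)) hs hs' k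
  obtain ⟨hz1, hz2, hz3⟩ := overlap_yyVec_single k
  obtain ⟨hy1, hy2⟩ := overlap_yyVec_yVec k
  have e1 := h.overlap_near (a := .YY k) (h.ref _) (h.close_Z (lo (fstEdge k)))
    (ne_of_overlap_ne_one h.pure (by rw [refState_YY, refState_Z, hz1]; norm_num))
  have e2 := h.overlap_near (a := .YY k) (h.ref _) (h.close_Z (hi (fstEdge k)))
    (ne_of_overlap_ne_one h.pure (by rw [refState_YY, refState_Z, hz2]; norm_num))
  have e3 := h.overlap_near (a := .YY k) (h.ref _) (h.close_Z (hi (sndEdge k)))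
    (ne_of_overlap_ne_one h.pure (by rw [refState_YY, refState_Z, hz3]; norm_num))
  have e4 := h.overlap_near (a := .YY k) (isState_proj (sum_norm_sq_yVec hs _)) h1
    (ne_of_overlap_ne_one h.pure (by rw [refState_YY, refState_Y, hy1]; norm_num))
  have e5 := h.overlap_near (a := .YY k) (isState_proj (sum_norm_sq_yVec hs' _)) h2
    (ne_of_overlap_ne_one h.pure (by rw [refState_YY, refState_Y, hy2]; norm_num))
  rw [refState_YY, refState_Z, hz1, abs_le] at e1
  rw [refState_YY, refState_Z, hz2, abs_le] at e2
  rw [refState_YY, refState_Z, hz3, abs_le] at e3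
  rw [refState_YY, refState_Y, hy1, abs_le] at e4
  rw [refState_YY, refState_Y, hy2, abs_le] at e5
  linarith

/-- The orientations of neighbouring edges agree: otherwise the overlap of `ρ (.YY k)` with
`ρ (.XX k)` would be close to `1 / 9` instead of `5 / 9`. -/
lemma IsXAligned.sign_eq (h : IsXAligned ψ ρ δp δo) (hs : IsSmall D δp δo) (k : Fin (D - 2))
    {s s' : ℝ} (hs1 : s = 1 ∨ s = -1) (hs1' : s' = 1 ∨ s' = -1)
    (h1 : traceNorm (ρ (.Y (fstEdge k)) - proj (yVec s (fstEdge k))) ≤ 24 * deltaX' D δp δo)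
    (h2 : traceNorm (ρ (.Y (sndEdge k)) - proj (yVec s' (sndEdge k))) ≤ 24 * deltaX' D δp δo) :
    s = s' := by
  by_contra hne
  have hss : s * s' = -1 := by
    rcases hs1 with rfl | rfl <;> rcases hs1' with rfl | rfl <;> simp at hne ⊢
  have hs2 : s ^ 2 = 1 := by rcases hs1 with rfl | rfl <;> norm_num
  have hs2' : s' ^ 2 = 1 := by rcases hs1' with rfl | rfl <;> norm_num
  have he' := hs.deltaX'_le
  have hYY := h.one_sub_overlap_YY_le k hs2 hs2' h1 h2
  have hXX := h.one_sub_overlap_XX_le hs k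
  have e1 := traceNorm_sub_proj_le (h.state (.YY k)) (sum_norm_sq_yyVec hs2 hs2' k)
  have e2 := traceNorm_sub_proj_le (h.state (.XX k)) (sum_norm_sq_xxVec k)
  have e3 := hs.δp_nonneg
  have e4 := δp_le_deltaX' hs
  have e5 : deltaX' D δp δo = deltaZ D δp δo / 2 + δp + δo := rfl
  have e6 : √(1 - overlap (ρ (.YY k)) (proj (yyVec s s' k))) ≤ 1 / 5 :=
    Real.sqrt_le_iff.2 ⟨by norm_num, by linarith⟩
  have e7 : √(1 - overlap (ρ (.XX k)) (proj (xxVec k))) ≤ 7 / 50 :=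
    Real.sqrt_le_iff.2 ⟨by norm_num, by linarith⟩
  have hyy := isState_proj (sum_norm_sq_yyVec hs2 hs2' k)
  have hxx := isState_proj (sum_norm_sq_xxVec (D := D) k)
  have f1 := abs_overlap_sub_le (h.state (.YY k)) hyy (h.state (.XX k))
  have f2 := abs_overlap_sub_le (h.state (.XX k)) hxx hyy
  rw [overlap_comm _ (proj (yyVec s s' k)), overlap_comm _ (proj (yyVec s s' k)),
    overlap_yyVec_xxVec hs2 hs2', hss] at f2
  have hr := overlap_yyVec_xxVec (one_pow 2) (one_pow 2) k
  have f3 := h.overlap_sub_le (a := .YY k) (b := .XX k)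
    (by rw [refState_YY, refState_XX, hr]; norm_num)
  rw [refState_YY, refState_XX, hr] at f3
  rw [abs_le] at f1 f2 f3
  linarith [hs.δo_nonneg]

lemma star_threeLevel (i j l : Fin D) (a b c : ℂ) :
    star (threeLevel i j l a b c) = threeLevel i j l (star a) (star b) (star c) := by
  simp only [threeLevel, star_add, star_smul, ← Pi.single_star, star_one]

lemma cc_proj_single (k : Fin D) : cc (proj (Pi.single k 1)) = proj (Pi.single k 1) := by
  rw [← proj_star, ← Pi.single_star, star_one]

lemma cc_proj_xVec (k : Fin (D - 1)) : cc (proj (xVec k)) = proj (xVec k) := by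
  rw [← proj_star, xVec, star_threeLevel]
  simp

lemma cc_proj_yVec (s : ℝ) (k : Fin (D - 1)) : cc (proj (yVec s k)) = proj (yVec (-s) k) := by
  rw [← proj_star, yVec, yVec, star_threeLevel]
  simp

/-- A family in which all of the states `Z`, `X`, `Y` are close to the reference states. -/
structure IsAligned (ψ : Fin M → Op D) (ρ : Label M D → Op D) (δp δo : ℝ) : Prop
    extends IsXAligned ψ ρ δp δo where
  close_Y : ∀ k, traceNorm (ρ (.Y k) - refState ψ (.Y k)) ≤ deltaY D δp δo

lemma IsXAligned.cc (h : IsXAligned ψ ρ δp δo) :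
    IsXAligned ψ (fun a => cc (ρ a)) δp δo where
  toIsApprox := h.toIsApprox.cc
  close_Z k := by
    have := h.close_Z k
    rwa [← traceNorm_cc_sub (h.state _) (h.ref _), refState_Z, cc_proj_single,
      ← refState_Z ψ] at this
  leading a := by
    obtain ⟨x, hx, hxρ, hx0⟩ := h.leading a
    refine ⟨star x, by simpa using hx, ?_, fun k hk => by simpa using hx0 k hk⟩
    rwa [proj_star, traceNorm_cc_sub (h.state _) (isState_proj hx)]
  close_X k := by
    have := h.close_X k
    rwa [← traceNorm_cc_sub (h.state _) (h.ref _), refState_X, cc_proj_xVec,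
      ← refState_X ψ] at this
  close_X' k := by
    have := h.close_X' k
    rwa [← traceNorm_cc_sub (h.state _) (h.ref _), refState_X, cc_proj_xVec,
      ← refState_X ψ] at this

/-- The orientation is constant along the path; if it is the wrong one, complex conjugation
corrects it. -/
lemma IsXAligned.aligned_or_cc_aligned (h : IsXAligned ψ ρ δp δo) (hs : IsSmall D δp δo)
    (hD : 3 ≤ D) : IsAligned ψ ρ δp δo ∨ IsAligned ψ (fun a => RobustWigner.cc (ρ a)) δp δo := by
  choose s hs1 hsY hsY' using h.exists_sign hs hD
  have hconst : ∀ n (hn : n < D - 1), s ⟨n, hn⟩ = s ⟨0, by omega⟩ := by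
    intro n
    induction n with
    | zero => intro _; rfl
    | succ n ih =>
      intro hn
      rw [← ih (by omega)]
      exact (h.sign_eq hs ⟨n, by omega⟩ (hs1 _) (hs1 _) (hsY' _) (hsY' _)).symm
  rcases hs1 ⟨0, by omega⟩ with h0 | h0
  · refine Or.inl ⟨h, fun k => ?_⟩
    have := hsY k
    rwa [hconst k k.2, h0, ← refState_Y ψ] at this
  · refine Or.inr ⟨h.cc, fun k => ?_⟩
    have := hsY k
    rwa [← traceNorm_cc_sub (h.state _)
      (isState_proj (sum_norm_sq_yVec (by rcases hs1 k with h | h <;> rw [h] <;> norm_num) k)),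
      cc_proj_yVec, hconst k k.2, h0, neg_neg, ← refState_Y ψ] at this

namespace IsAligned

lemma close_XX (h : IsAligned ψ ρ δp δo) (hs : IsSmall D δp δo) (k : Fin (D - 2)) :
    traceNorm (ρ (.XX k) - refState ψ (.XX k)) ≤ deltaXX D δp δo := by
  rw [refState_XX, deltaXX]
  refine (traceNorm_sub_proj_le (h.state _) (sum_norm_sq_xxVec k)).trans
    (mul_le_mul_of_nonneg_left (Real.sqrt_le_sqrt ((h.one_sub_overlap_XX_le hs k).trans ?_))
      zero_le_two)
  have h1 := hs.deltaX'_le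
  have h2 := hs.δp_nonneg
  have h3 := hs.δo_nonneg
  have h4 := deltaZ_nonneg D h2 δo
  -- As `deltaX` is of order `√deltaX'`, it dominates the linear bound for small `deltaX'`.
  have h5 : √(deltaX' D δp δo) ^ 2 = deltaX' D δp δo := Real.sq_sqrt (deltaX'_nonneg hs)
  have h6 : √(deltaX' D δp δo) ≤ 1 / 38 := Real.sqrt_le_iff.2 ⟨by norm_num, by linarith⟩
  have h7 : 1 ≤ √2 := Real.one_le_sqrt.2 (by norm_num)
  have h8 := Real.sqrt_nonneg (deltaX' D δp δo)
  have h9 : 2 * √(deltaX' D δp δo) ≤ deltaX D δp δo := by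
    rw [deltaX]; nlinarith
  nlinarith

lemma close_YY (h : IsAligned ψ ρ δp δo) (k : Fin (D - 2)) :
    traceNorm (ρ (.YY k) - refState ψ (.YY k)) ≤ deltaYY D δp δo := by
  rw [refState_YY, deltaYY]
  have h1 := h.close_Y (fstEdge k)
  have h2 := h.close_Y (sndEdge k)
  rw [refState_Y] at h1 h2
  exact (traceNorm_sub_proj_le (h.state _) (sum_norm_sq_yyVec (one_pow 2) (one_pow 2) k)).trans
    (mul_le_mul_of_nonneg_left (Real.sqrt_le_sqrt
      (h.one_sub_overlap_YY_le k (one_pow 2) (one_pow 2) h1 h2)) zero_le_two)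

end IsAligned

/-! ### The spectral gap of the path -/

/-- The ground-state substitution for the Dirichlet Laplacian on the path, with ground state
`sin (π k / (n + 1))`. -/
lemma dirichlet_le (n : ℕ) (d : ℕ → ℝ) (h0 : d 0 = 0) (hn : d (n + 1) = 0) :
    2 * (1 - Real.cos (Real.pi / (n + 1 : ℕ))) * ∑ k ∈ Finset.range n, d (k + 1) ^ 2 ≤
      ∑ k ∈ Finset.range (n + 1), (d (k + 1) - d k) ^ 2 := by
  set θ : ℝ := Real.pi / (n + 1 : ℕ) with hθ
  have hθn : θ * (n + 1 : ℕ) = Real.pi := by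
    rw [hθ]; field_simp
  have hθ0 : 0 < θ := by rw [hθ]; positivity
  set s : ℕ → ℝ := fun k => Real.sin (θ * k) with hs
  have hspos : ∀ k, k < n → 0 < s (k + 1) := by
    intro k hk
    apply Real.sin_pos_of_pos_of_lt_pi
    · positivity
    · rw [← hθn]
      refine mul_lt_mul_of_pos_left ?_ hθ0
      exact_mod_cast Nat.succ_lt_succ hk
  have hrec : ∀ k, s k + s (k + 2) = 2 * Real.cos θ * s (k + 1) := by
    intro k
    have e1 : θ * (k : ℕ) = θ * (k + 1 : ℕ) - θ := by push_cast; ring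
    have e2 : θ * (k + 2 : ℕ) = θ * (k + 1 : ℕ) + θ := by push_cast; ring
    simp only [hs]
    rw [e1, e2, Real.sin_sub, Real.sin_add]
    ring
  have hpart : ∀ m, m < n → 2 * (1 - Real.cos θ) * ∑ k ∈ Finset.range m, d (k + 1) ^ 2 +
      d (m + 1) ^ 2 * (1 - s m / s (m + 1)) ≤
        ∑ k ∈ Finset.range (m + 1), (d (k + 1) - d k) ^ 2 := by
    intro m
    induction m with
    | zero => intro _; simp [h0, hs]
    | succ m ih =>
      intro hm
      have ih := ih (by omega)
      rw [Finset.sum_range_succ, Finset.sum_range_succ _ (m + 1)]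
      have p1 := hspos m (by omega)
      have p2 := hspos (m + 1) hm
      have hr := hrec m
      have hsq : d (m + 1) ^ 2 * (1 - s (m + 2) / s (m + 1)) +
          d (m + 2) ^ 2 * (1 - s (m + 1) / s (m + 2)) ≤ (d (m + 1 + 1) - d (m + 1)) ^ 2 := by
        have : (d (m + 2) - d (m + 1)) ^ 2 - (d (m + 1) ^ 2 * (1 - s (m + 2) / s (m + 1)) +
            d (m + 2) ^ 2 * (1 - s (m + 1) / s (m + 2))) =
            (d (m + 2) * s (m + 1) - d (m + 1) * s (m + 2)) ^ 2 / (s (m + 1) * s (m + 2)) := by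
          field_simp
          ring
        have h2 : 0 ≤ (d (m + 2) * s (m + 1) - d (m + 1) * s (m + 2)) ^ 2 /
            (s (m + 1) * s (m + 2)) := by positivity
        linarith
      have hcoef : (1 - s m / s (m + 1)) + (1 - s (m + 2) / s (m + 1)) =
          2 * (1 - Real.cos θ) := by
        field_simp
        linarith
      have := congrArg (fun t => d (m + 1) ^ 2 * t) hcoef
      simp only [mul_add] at this
      rw [show m + 1 + 1 = m + 2 from rfl] at *
      linarith
  rcases Nat.eq_zero_or_pos n with rfl | hpos
  · simp [h0, hn]
  · obtain ⟨m, rfl⟩ : ∃ m, n = m + 1 := ⟨n - 1, by omega⟩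
    have hm := hpart m (by omega)
    rw [Finset.sum_range_succ _ (m + 1), hn, Finset.sum_range_succ]
    have p1 := hspos m (by omega)
    have hr := hrec m
    have hs0 : s (m + 2) = 0 := by
      simp only [hs]
      rw [hθn, Real.sin_pi]
    rw [hs0, add_zero] at hr
    have hcoef : (1 - s m / s (m + 1)) + 1 = 2 * (1 - Real.cos θ) := by
      rw [hr]; field_simp; ring
    have := congrArg (fun t => d (m + 1) ^ 2 * t) hcoef
    simp only [mul_add] at this
    linarith

/-- The discrete Poincaré inequality on the path, with the optimal constant. It is dual to
`dirichlet_le` because every sequence of sum zero is the difference sequence of its partial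
sums. -/
lemma poincare_range (n : ℕ) (y : ℕ → ℝ) (hy : ∑ k ∈ Finset.range (n + 1), y k = 0) :
    2 * (1 - Real.cos (Real.pi / (n + 1 : ℕ))) * ∑ k ∈ Finset.range (n + 1), y k ^ 2 ≤
      ∑ k ∈ Finset.range n, (y k - y (k + 1)) ^ 2 := by
  set d : ℕ → ℝ := fun k => ∑ i ∈ Finset.range k, y i with hd
  have hyd : ∀ k, y k = d (k + 1) - d k := fun k => by simp [hd, Finset.sum_range_succ]
  have hdir := dirichlet_le n d (by simp [hd]) hy
  simp only [← hyd] at hdir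
  have hparts : ∑ k ∈ Finset.range (n + 1), y k ^ 2 =
      ∑ k ∈ Finset.range n, d (k + 1) * (y k - y (k + 1)) := by
    have e1 : ∀ k, y k ^ 2 = y k * d (k + 1) - y k * d k := fun k => by
      have := hyd k
      calc y k ^ 2 = y k * y k := sq _
        _ = y k * (d (k + 1) - d k) := by rw [← this]
        _ = _ := by ring
    rw [Finset.sum_congr rfl (fun k _ => e1 k), Finset.sum_sub_distrib,
      Finset.sum_range_succ (fun k => y k * d (k + 1)),
      Finset.sum_range_succ' (fun k => y k * d k), show d (n + 1) = 0 from hy,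
      show d 0 = 0 by simp [hd], mul_zero, mul_zero, add_zero, add_zero,
      ← Finset.sum_sub_distrib]
    exact Finset.sum_congr rfl fun k _ => by ring
  have hcs := Finset.sum_mul_sq_le_sq_mul_sq (Finset.range n) (fun k => d (k + 1))
    (fun k => y k - y (k + 1))
  rw [← hparts] at hcs
  set Y := ∑ k ∈ Finset.range (n + 1), y k ^ 2
  set S := ∑ k ∈ Finset.range n, d (k + 1) ^ 2
  set E := ∑ k ∈ Finset.range n, (y k - y (k + 1)) ^ 2
  have hY : 0 ≤ Y := Finset.sum_nonneg fun k _ => sq_nonneg _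
  have hE : 0 ≤ E := Finset.sum_nonneg fun k _ => sq_nonneg _
  have hl : 0 ≤ 2 * (1 - Real.cos (Real.pi / (n + 1 : ℕ))) := by
    have := Real.cos_le_one (Real.pi / (n + 1 : ℕ)); linarith
  rcases hY.eq_or_lt with h | h
  · rw [← h]; simpa using hE
  · refine le_of_mul_le_mul_right ?_ h
    nlinarith

lemma poincare (hD : 1 ≤ D) (y : Fin D → ℂ) (hy : ∑ i, y i = 0) :
    2 * (1 - Real.cos (Real.pi / D)) * ∑ i, ‖y i‖ ^ 2 ≤
      ∑ k : Fin (D - 1), ‖y (lo k) - y (hi k)‖ ^ 2 := by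
  obtain ⟨n, rfl⟩ : ∃ n, D = n + 1 := ⟨D - 1, by omega⟩
  have key : ∀ z : Fin (n + 1) → ℝ, ∑ i, z i = 0 →
      2 * (1 - Real.cos (Real.pi / (n + 1 : ℕ))) * ∑ i, z i ^ 2 ≤
        ∑ k : Fin n, (z k.castSucc - z k.succ) ^ 2 := by
    intro z hz
    set w : ℕ → ℝ := fun m => if h : m < n + 1 then z ⟨m, h⟩ else 0 with hw
    have hwz : ∀ i : Fin (n + 1), z i = w i := fun i => by
      simp only [hw, dif_pos i.2]
    have h := poincare_range n w (by
      rw [← Fin.sum_univ_eq_sum_range, ← hz]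
      exact Finset.sum_congr rfl fun i _ => (hwz i).symm)
    rw [← Fin.sum_univ_eq_sum_range (fun m => w m ^ 2),
      ← Fin.sum_univ_eq_sum_range (fun m => (w m - w (m + 1)) ^ 2)] at h
    simp only [hwz]
    exact h
  have h1 := key (fun i => (y i).re) (by rw [← Complex.re_sum, hy]; rfl)
  have h2 := key (fun i => (y i).im) (by rw [← Complex.im_sum, hy]; rfl)
  simp only [Complex.sq_norm, Complex.normSq_apply, ← sq, Finset.sum_add_distrib, mul_add,
    Complex.sub_re, Complex.sub_im]
  exact add_le_add h1 h2

/-! ### Reference states with full support -/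

/-- The vector orthogonal to `c` in the span of the two basis vectors at the edge `k`. -/
noncomputable def edgeVec (c : Fin D → ℂ) (k : Fin (D - 1)) : Fin D → ℂ :=
  threeLevel (lo k) (hi k) (hi k) (star (c (lo k))⁻¹) (-star (c (hi k))⁻¹) 0

lemma star_edgeVec_dotProduct (c x : Fin D → ℂ) (k : Fin (D - 1)) :
    star (edgeVec c k) ⬝ᵥ x = (c (lo k))⁻¹ * x (lo k) - (c (hi k))⁻¹ * x (hi k) := by
  rw [edgeVec, star_threeLevel, threeLevel]
  simp only [add_dotProduct, smul_dotProduct, single_one_dotProduct, star_neg, star_star,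
    star_zero, smul_eq_mul]
  ring

/-- The spectral gap of the parent Hamiltonian `∑ k, |edgeVec c k⟩⟨edgeVec c k|` of `c`: it is the
path Laplacian in the rescaled amplitudes `x i / c i`. -/
lemma gap_vector {c : Fin D → ℂ} (hc : ∑ i, ‖c i‖ ^ 2 = 1) (hc0 : ∀ i, c i ≠ 0) {p : ℝ}
    (hp : ∀ i, ‖c i‖ ^ 2 ≤ p) (hD : 1 ≤ D) (x : Fin D → ℂ) :
    2 * (1 - Real.cos (Real.pi / D)) * (∑ i, ‖x i‖ ^ 2 - ‖star c ⬝ᵥ x‖ ^ 2) ≤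
      p * ∑ k, ‖star (edgeVec c k) ⬝ᵥ x‖ ^ 2 := by
  set y : Fin D → ℂ := fun i => (c i)⁻¹ * x i with hy
  have hxy : ∀ i, x i = c i * y i := fun i => by rw [hy]; field_simp [hc0 i]
  set z : ℂ := (∑ i, y i) / D with hz
  have hD' : (D : ℂ) ≠ 0 := by exact_mod_cast (by omega : D ≠ 0)
  have hp0 : 0 ≤ p := (sq_nonneg _).trans (hp ⟨0, by omega⟩)
  have hP := poincare hD (fun i => y i - z) (by
    rw [Finset.sum_sub_distrib, Finset.sum_const, Finset.card_univ, Fintype.card_fin,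
      nsmul_eq_mul, hz, mul_div_cancel₀ _ hD', sub_self])
  simp only [sub_sub_sub_cancel_right] at hP
  simp only [star_edgeVec_dotProduct]
  -- The mean of `y` with respect to the weights `‖c i‖ ^ 2` minimizes the quadratic deviation.
  have hvar : ∑ i, ‖x i‖ ^ 2 - ‖star c ⬝ᵥ x‖ ^ 2 ≤ ∑ i, ‖c i‖ ^ 2 * ‖y i - z‖ ^ 2 := by
    have e1 : ∑ i, ‖c i‖ ^ 2 * ‖y i - z‖ ^ 2 =
        ∑ i, ‖(x - z • c) i‖ ^ 2 := Finset.sum_congr rfl fun i _ => by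
      rw [← mul_pow, ← norm_mul]
      simp only [Pi.sub_apply, Pi.smul_apply, smul_eq_mul, hxy i]
      congr 2; ring
    have e2 : star (x - z • c) ⬝ᵥ (x - z • c) = star x ⬝ᵥ x - star (star c ⬝ᵥ x) * (star c ⬝ᵥ x)
        + star (star c ⬝ᵥ x - z) * (star c ⬝ᵥ x - z) := by
      have h1 : star x ⬝ᵥ c = star (star c ⬝ᵥ x) := by rw [star_dotProduct]
      have h2 : star c ⬝ᵥ c = 1 := by rw [star_dotProduct_self, hc]; simp
      simp only [star_sub, star_smul, sub_dotProduct, dotProduct_sub, smul_dotProduct,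
        dotProduct_smul, smul_eq_mul, h1, h2]
      ring
    have e3 := congrArg Complex.re e2
    rw [star_dotProduct_self, star_dotProduct_self] at e3
    simp only [RCLike.star_def, Complex.conj_mul', ← Complex.ofReal_pow, Complex.add_re, Complex.sub_re, Complex.ofReal_re] at e3
    rw [e1, e3]
    linarith [sq_nonneg ‖star c ⬝ᵥ x - z‖]
  have hmax : ∑ i, ‖c i‖ ^ 2 * ‖y i - z‖ ^ 2 ≤ p * ∑ i, ‖y i - z‖ ^ 2 := by
    rw [Finset.mul_sum]
    exact Finset.sum_le_sum fun i _ => mul_le_mul_of_nonneg_right (hp i) (sq_nonneg _)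
  have hl : 0 ≤ 2 * (1 - Real.cos (Real.pi / D)) := by
    have := Real.cos_le_one (Real.pi / D); linarith
  calc _ ≤ 2 * (1 - Real.cos (Real.pi / D)) * (p * ∑ i, ‖y i - z‖ ^ 2) :=
        mul_le_mul_of_nonneg_left (hvar.trans hmax) hl
    _ = p * (2 * (1 - Real.cos (Real.pi / D)) * ∑ i, ‖y i - z‖ ^ 2) := by ring
    _ ≤ _ := mul_le_mul_of_nonneg_left hP hp0

lemma overlap_sum_right {ι : Type*} (s : Finset ι) (A : Op D) (B : ι → Op D) :
    overlap A (∑ k ∈ s, B k) = ∑ k ∈ s, overlap A (B k) := by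
  simp [overlap, Finset.mul_sum, trace_sum]

lemma overlap_smul_right (r : ℝ) (A B : Op D) :
    overlap A ((r : ℂ) • B) = r * overlap A B := by
  simp [overlap]

/-- The operator inequality `λ (1 - |c⟩⟨c|) ≤ p ∑ k, |edgeVec c k⟩⟨edgeVec c k|`, tested on a
state. -/
lemma gap_state {c : Fin D → ℂ} (hc : ∑ i, ‖c i‖ ^ 2 = 1) (hc0 : ∀ i, c i ≠ 0) {p : ℝ}
    (hp : ∀ i, ‖c i‖ ^ 2 ≤ p) (hD : 1 ≤ D) {ρ : Op D} (hρ : IsState ρ) :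
    2 * (1 - Real.cos (Real.pi / D)) * (1 - overlap ρ (proj c)) ≤
      p * ∑ k, overlap ρ (proj (edgeVec c k)) := by
  set K : Op D := (p : ℂ) • ∑ k, proj (edgeVec c k) -
    ((2 * (1 - Real.cos (Real.pi / D)) : ℝ) : ℂ) • (1 - proj c) with hK
  have hover : ∀ A : Op D, overlap A K = p * ∑ k, overlap A (proj (edgeVec c k)) -
      2 * (1 - Real.cos (Real.pi / D)) * (A.trace.re - overlap A (proj c)) := fun A => by
    rw [hK, overlap_sub_right, overlap_smul_right, overlap_smul_right, overlap_sum_right,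
      overlap_sub_right, overlap_one_right]
  have hsa : ∀ r : ℝ, IsSelfAdjoint (r : ℂ) := fun r => Complex.conj_ofReal r
  have hKH : K.IsHermitian := by
    refine IsHermitian.sub ?_ ?_
    · refine IsSelfAdjoint.smul (hsa _) ?_
      exact isSelfAdjoint_sum _ fun k _ => (posSemidef_proj _).1
    · exact IsSelfAdjoint.smul (hsa _) (isHermitian_one.sub (posSemidef_proj c).1)
  have hKpos : K.PosSemidef := by
    refine .of_dotProduct_mulVec_nonneg hKH fun x => ?_
    have him : (star x ⬝ᵥ (K *ᵥ x)).im = 0 := hKH.im_star_dotProduct_mulVec_self x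
    refine Complex.nonneg_iff.2 ⟨?_, him.symm⟩
    rw [← overlap_proj, overlap_comm, hover, ← sum_norm_sq_eq]
    have := gap_vector hc hc0 hp hD x
    simp only [← overlap_proj_proj] at this
    simp only [overlap_comm (proj x)]
    linarith
  have := overlap_nonneg hρ.1 hKpos
  rw [hover, hρ.2, Complex.one_re] at this
  linarith

lemma mul_le_of_abs_le {a b A B : ℝ} (ha : |a| ≤ A) (hb : |b| ≤ B) : a * b ≤ A * B :=
  (le_abs_self _).trans (by
    rw [abs_mul]; exact mul_le_mul ha hb (abs_nonneg b) ((abs_nonneg a).trans ha))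

/-- The edge terms of the parent Hamiltonian are combinations of `Z`, `X`, `Y` with coefficients
of order `F`, if `1 / F` bounds the weights of `c` from below. -/
lemma overlap_edgeVec_le {c : Fin D → ℂ} {F : ℝ} (hF : 0 < F) (hcF : ∀ i, 1 / F ≤ ‖c i‖ ^ 2)
    {ρ : Op D} (hρ : ρ.IsHermitian) (k : Fin (D - 1)) {ζ εx εy : ℝ}
    (hlo : |overlap ρ (proj (Pi.single (lo k) 1)) -
      overlap (proj c) (proj (Pi.single (lo k) 1))| ≤ ζ)
    (hhi : |overlap ρ (proj (Pi.single (hi k) 1)) -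
      overlap (proj c) (proj (Pi.single (hi k) 1))| ≤ ζ)
    (hx : |overlap ρ (proj (xVec k)) - overlap (proj c) (proj (xVec k))| ≤ εx)
    (hy : |overlap ρ (proj (yVec 1 k)) - overlap (proj c) (proj (yVec 1 k))| ≤ εy) :
    overlap ρ (proj (edgeVec c k)) ≤ 2 * F * (1 + √2) * ζ + 2 * F * εx + 2 * F * εy := by
  have hpos : ∀ i, 0 < ‖c i‖ ^ 2 := fun i => lt_of_lt_of_le (by positivity) (hcF i)
  have hc0 : ∀ i, c i ≠ 0 := fun i h => by have := hpos i; simp [h] at this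
  have hcinv : ∀ i, ‖(c i)⁻¹‖ ^ 2 ≤ F := fun i => by
    rw [norm_inv, inv_pow]
    exact inv_le_of_inv_le₀ hF (by rw [← one_div]; exact hcF i)
  have h0 : overlap (proj c) (proj (edgeVec c k)) = 0 := by
    rw [overlap_comm, overlap_proj_proj, star_edgeVec_dotProduct, inv_mul_cancel₀ (hc0 _),
      inv_mul_cancel₀ (hc0 _)]
    simp
  have hA : ∀ A : Op D, A.IsHermitian → overlap A (proj (edgeVec c k)) =
      ‖(c (lo k))⁻¹‖ ^ 2 * (A (lo k) (lo k)).re + ‖(c (hi k))⁻¹‖ ^ 2 * (A (hi k) (hi k)).re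
        - 2 * ((c (lo k))⁻¹ * star (c (hi k))⁻¹ * A (lo k) (hi k)).re := by
    intro A hA
    rw [edgeVec, overlap_threeLevel hA]
    simp
    ring
  have hP := (posSemidef_proj c).1
  rw [hA _ hP] at h0
  rw [hA _ hρ]
  rw [overlap_single, overlap_single] at hlo hhi
  rw [overlap_xVec hρ, overlap_xVec hP] at hx
  rw [overlap_yVec hρ (one_pow 2), overlap_yVec hP (one_pow 2)] at hy
  have hα := hcinv (lo k)
  have hβ := hcinv (hi k)
  have hα0 := sq_nonneg ‖(c (lo k))⁻¹‖
  have hβ0 := sq_nonneg ‖(c (hi k))⁻¹‖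
  have hg : ((c (lo k))⁻¹ * star (c (hi k))⁻¹).re ^ 2 + ((c (lo k))⁻¹ * star (c (hi k))⁻¹).im ^ 2 =
      ‖(c (lo k))⁻¹‖ ^ 2 * ‖(c (hi k))⁻¹‖ ^ 2 := by
    rw [← mul_pow, ← norm_star (c (hi k))⁻¹, ← norm_mul, Complex.sq_norm, Complex.normSq_apply]
    ring
  rw [Complex.mul_re] at h0 ⊢
  set g := (c (lo k))⁻¹ * star (c (hi k))⁻¹
  set α := ‖(c (lo k))⁻¹‖ ^ 2
  set β := ‖(c (hi k))⁻¹‖ ^ 2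
  have hαβ : α * β ≤ F ^ 2 := by rw [sq]; exact mul_le_mul hα hβ hβ0 hF.le
  have hgre : |g.re| ≤ F := abs_le_of_sq_le_sq (by nlinarith [sq_nonneg g.im]) hF.le
  have hgim : |g.im| ≤ F := abs_le_of_sq_le_sq (by nlinarith [sq_nonneg g.re]) hF.le
  have hs2 : √2 ^ 2 = 2 := Real.sq_sqrt zero_le_two
  have hgsum : |g.re + g.im| ≤ √2 * F :=
    abs_le_of_sq_le_sq (by rw [mul_pow, hs2]; nlinarith [sq_nonneg (g.re - g.im)]) (by positivity)
  have c1 : |α + (g.re + g.im)| ≤ F * (1 + √2) := by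
    refine (abs_add_le _ _).trans ?_
    rw [abs_of_nonneg hα0]; linarith
  have c2 : |β + (g.re + g.im)| ≤ F * (1 + √2) := by
    refine (abs_add_le _ _).trans ?_
    rw [abs_of_nonneg hβ0]; linarith
  have t1 := mul_le_of_abs_le c1 hlo
  have t2 := mul_le_of_abs_le c2 hhi
  have t3 := mul_le_of_abs_le (by rwa [abs_neg] : |-g.re| ≤ F) hx
  have t4 := mul_le_of_abs_le (by rwa [abs_neg] : |-g.im| ≤ F) hy
  linarith

lemma exists_ne_ne (hD : 3 ≤ D) (a b : Fin D) : ∃ i, i ≠ a ∧ i ≠ b := by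
  obtain ⟨i, -, hi⟩ := Finset.exists_mem_notMem_of_card_lt_card
    (s := {a, b}) (t := (Finset.univ : Finset (Fin D)))
    (lt_of_le_of_lt Finset.card_le_two (by rw [Finset.card_univ, Fintype.card_fin]; omega))
  simp only [Finset.mem_insert, Finset.mem_singleton, not_or] at hi
  exact ⟨i, hi⟩

lemma deltaY_nonneg (D : ℕ) {δp : ℝ} (h : 0 ≤ δp) (δo : ℝ) : 0 ≤ deltaY D δp δo := by
  unfold deltaY; positivity

lemma deltaX_nonneg (D : ℕ) {δp : ℝ} (h : 0 ≤ δp) (δo : ℝ) : 0 ≤ deltaX D δp δo := by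
  unfold deltaX; positivity

/-- The energy of `ρ (.psi j)` under the parent Hamiltonian of `ψ j` is small, and by the spectral
gap `2 * xi D F` so is its infidelity. -/
lemma IsAligned.close_psi
    (h : IsAligned ψ ρ δp δo) (hs : IsSmall D δp δo) (hD : 3 ≤ D) {j : Fin M} {F : ℝ} (hF : 0 < F)
    (hov : ∀ k, 1 / F < overlap (ψ j) (refState ψ (.Z k))) :
    traceNorm (ρ (.psi j) - refState ψ (.psi j)) ≤ deltaPsi D F δp δo := by
  have hD' : (3 : ℝ) ≤ D := by exact_mod_cast hD
  obtain ⟨c, hc, hψ⟩ := h.pure j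
  have hcF : ∀ i, 1 / F < ‖c i‖ ^ 2 := fun i => by
    have := hov i
    rwa [hψ, refState_Z, overlap_single, proj_apply, RCLike.star_def, Complex.mul_conj',
      ← Complex.ofReal_pow, Complex.ofReal_re] at this
  have hpos : ∀ i, 0 < ‖c i‖ ^ 2 := fun i => lt_trans (by positivity) (hcF i)
  have hc0 : ∀ i, c i ≠ 0 := fun i h => by have := hpos i; simp [h] at this
  have hmax : ∀ i, ‖c i‖ ^ 2 ≤ 1 - ((D : ℝ) - 1) / F := by
    intro i
    have h1 := Finset.add_sum_erase Finset.univ (fun i => ‖c i‖ ^ 2) (Finset.mem_univ i)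
    have h2 := Finset.card_nsmul_le_sum (Finset.univ.erase i) (fun i => ‖c i‖ ^ 2) (1 / F)
      (fun i _ => (hcF i).le)
    rw [Finset.card_erase_of_mem (Finset.mem_univ _), Finset.card_univ, Fintype.card_fin,
      nsmul_eq_mul, Nat.cast_sub (by omega), Nat.cast_one, mul_one_div] at h2
    simp only [hc] at h1
    linarith
  set p : ℝ := 1 - ((D : ℝ) - 1) / F with hp
  have hp0 : 0 < p := (hpos ⟨0, by omega⟩).trans_le (hmax _)
  -- Full support distinguishes `ψ j` from the reference states `Z`, `X` and `Y`.
  have hne : ∀ (b : Label M D) i, overlap (refState ψ b) (refState ψ (.Z i)) = 0 →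
      refState ψ (.psi j) ≠ refState ψ b := by
    intro b i hb hj
    have h1 : (0 : ℝ) < 1 / F := by positivity
    have h2 : refState ψ (.psi j) = ψ j := rfl
    rw [← hj, h2] at hb
    linarith [hov i]
  have eZ : ∀ k, |overlap (ρ (.psi j)) (proj (Pi.single k 1)) -
      overlap (proj c) (proj (Pi.single k 1))| ≤ deltaZ D δp δo / 2 + δo := by
    intro k
    obtain ⟨i, hi, -⟩ := exists_ne_ne hD k k
    have := h.overlap_near (a := .psi j) (h.ref _) (h.close_Z k) (hne _ i (by
      rw [refState_Z, refState_Z, overlap_single, proj_apply]; simp [hi]))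
    rwa [refState_Z, refState, hψ] at this
  have eX : ∀ k, |overlap (ρ (.psi j)) (proj (xVec k)) -
      overlap (proj c) (proj (xVec k))| ≤ deltaX D δp δo / 2 + δo := by
    intro k
    obtain ⟨i, hi, hi'⟩ := exists_ne_ne hD (lo k) (hi k)
    have := h.overlap_near (a := .psi j) (h.ref _) (h.close_X k) (hne _ i (by
      rw [refState_X, refState_Z]; exact (overlap_xVec_single k).2.2 i hi hi'))
    rwa [refState_X, refState, hψ] at this
  have eY : ∀ k, |overlap (ρ (.psi j)) (proj (yVec 1 k)) -
      overlap (proj c) (proj (yVec 1 k))| ≤ deltaY D δp δo / 2 + δo := by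
    intro k
    obtain ⟨i, hi, hi'⟩ := exists_ne_ne hD (lo k) (hi k)
    have := h.overlap_near (a := .psi j) (h.ref _) (h.close_Y k) (hne _ i (by
      rw [refState_Y, refState_Z]; exact (overlap_yVec_single (one_pow 2) k).2.2 i hi hi'))
    rwa [refState_Y, refState, hψ] at this
  have hgap := gap_state hc hc0 hmax (by omega) (h.state (.psi j))
  have hsum := Finset.sum_le_card_nsmul (Finset.univ : Finset (Fin (D - 1))) _ _ (fun k _ =>
    overlap_edgeVec_le hF (fun i => (hcF i).le) (h.state (.psi j)).1.1 k (eZ _) (eZ _) (eX k)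
      (eY k))
  rw [Finset.card_univ, Fintype.card_fin, nsmul_eq_mul, Nat.cast_sub (by omega),
    Nat.cast_one] at hsum
  have hcos : 0 < 1 - Real.cos (Real.pi / D) := by
    have h1 : Real.cos (Real.pi / D) < Real.cos 0 :=
      Real.cos_lt_cos_of_nonneg_of_le_pi le_rfl (div_le_self Real.pi_pos.le (by linarith))
        (by positivity)
    rw [Real.cos_zero] at h1; linarith
  have hxi : xi D F = 1 / p * (1 - Real.cos (Real.pi / D)) := rfl
  have hxi0 : 0 < xi D F := by rw [hxi]; positivity
  have hfin : 2 * xi D F * (1 - overlap (ρ (.psi j)) (proj c)) ≤ ((D : ℝ) - 1) *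
      (2 * F * (1 + √2) * (deltaZ D δp δo / 2 + δo) + 2 * F * (deltaX D δp δo / 2 + δo)
        + 2 * F * (deltaY D δp δo / 2 + δo)) := by
    refine le_trans ?_ hsum
    rw [hxi]
    refine le_of_mul_le_mul_left ?_ hp0
    refine le_trans (le_of_eq ?_) hgap
    field_simp
  have hZ0 := deltaZ_nonneg D hs.δp_nonneg δo
  rw [refState, hψ, deltaPsi]
  refine (traceNorm_sub_proj_le (h.state _) hc).trans
    (mul_le_mul_of_nonneg_left (Real.sqrt_le_sqrt ?_) zero_le_two)
  rw [← le_div_iff₀' (by positivity)] at hfin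
  refine hfin.trans (le_of_sub_nonneg ?_)
  have : (0 : ℝ) ≤ D * deltaZ D δp δo + D * δo := by have := hs.δo_nonneg; positivity
  refine this.trans (le_of_eq ?_)
  field_simp
  ring

/-! ### The explicit error bounds -/

lemma IsApprox.δo_nonneg (h : IsApprox ψ ρ δp δo) (hD : 3 ≤ D) : 0 ≤ δo := by
  refine (abs_nonneg _).trans (h.overlap_sub_le (a := .Z ⟨0, by omega⟩) (b := .Z ⟨1, by omega⟩) ?_)
  rw [refState_Z, refState_Z, overlap_single, proj_apply]
  simp

/-- `deltaXX` dominates a multiple of `deltaX' ^ (1 / 4)`, so the numerical hypothesis forces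
`deltaX'` to be tiny. -/
lemma deltaX'_le_of_deltaXX (hp : 0 ≤ δp) (ho : 0 ≤ δo) (h : deltaXX D δp δo ≤ 0.5876) :
    deltaX' D δp δo ≤ 1 / 1500 := by
  have hZ := deltaZ_nonneg D hp δo
  have hX := deltaX_nonneg D hp δo
  have hX' : 0 ≤ deltaX' D δp δo := by unfold deltaX'; positivity
  have h1 : √(6 / 5 * deltaX D δp δo + 9 / 10 * deltaZ D δp δo + 21 / 5 * δo) ≤ 0.2938 := by
    rw [deltaXX] at h; linarith
  have h2 := (Real.sqrt_le_left (by norm_num)).1 h1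
  have h3 : deltaX D δp δo ≤ 0.0720 := by norm_num at h2 ⊢; linarith
  have h4 : 2 * √2 * √(deltaX' D δp δo) ≤ 0.0720 := by rw [deltaX] at h3; linarith
  have h5 : (2 * √2 * √(deltaX' D δp δo)) ^ 2 ≤ 0.0720 ^ 2 :=
    pow_le_pow_left₀ (by positivity) h4 2
  rw [mul_pow, mul_pow, Real.sq_sqrt zero_le_two, Real.sq_sqrt hX'] at h5
  norm_num at h5 ⊢
  linarith

lemma sq_mul_deltaZ'_le_deltaZ_sq (hD : 3 ≤ D) (hp : 0 ≤ δp) (ho : 0 ≤ δo)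
    (h : deltaZ' δp δo < 1 / ((D : ℝ) - 1) ^ 2) :
    ((D : ℝ) - 1) ^ 2 * deltaZ' δp δo ≤ 2 * deltaZ D δp δo ^ 2 := by
  have hD' : (3 : ℝ) ≤ D := by exact_mod_cast hD
  have hδ : 0 ≤ deltaZ' δp δo := by unfold deltaZ'; positivity
  rw [lt_div_iff₀ (by nlinarith)] at h
  set t := deltaZ' δp δo / 8 * ((D : ℝ) - 1) ^ 2 with ht
  have ht0 : 0 ≤ t := by positivity
  have ht1 : t ≤ 1 := by rw [ht]; linarith
  have h1 : 2 * √(1 - (1 - t) ^ 2) ≤ deltaZ D δp δo := by rw [deltaZ]; linarith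
  have h2 : 2 * √t ≤ 2 * √(1 - (1 - t) ^ 2) :=
    mul_le_mul_of_nonneg_left (Real.sqrt_le_sqrt (by nlinarith)) zero_le_two
  have h3 := pow_le_pow_left₀ (by positivity) (h2.trans h1) 2
  rw [mul_pow, Real.sq_sqrt ht0] at h3
  linarith

lemma IsApprox.isSmall (h : IsApprox ψ ρ δp δo) (hD : 3 ≤ D)
    (hZ : deltaZ' δp δo < 1 / ((D : ℝ) - 1) ^ 2)
    (hnum : -0.2938 + 0.7970 * deltaY D δp δo + 2.2555 * deltaZ D δp δo
        + 0.5 * deltaXX D δp δo + 7.1049 * δo < 0) : IsSmall D δp δo := by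
  have ho := h.δo_nonneg hD
  have hp := h.δp_nonneg (.Z ⟨0, by omega⟩)
  have h1 := deltaZ_nonneg D hp δo
  have h2 := deltaY_nonneg D hp δo
  have h3 : deltaXX D δp δo ≤ 0.5876 := by norm_num at hnum ⊢; linarith
  refine ⟨hp, ho, deltaX'_le_of_deltaXX hp ho h3, ?_⟩
  have h4 := sq_mul_deltaZ'_le_deltaZ_sq hD hp ho hZ
  have h5 : deltaZ D δp δo ≤ 2 * deltaX' D δp δo := by unfold deltaX'; linarith
  nlinarith

lemma IsAligned.close (h : IsAligned ψ ρ δp δo) (hs : IsSmall D δp δo) (hD : 3 ≤ D)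
    {f : Fin M → ℝ} (hf : ∀ j, 0 < f j)
    (hov : ∀ j k, 1 / f j < overlap (ψ j) (refState ψ (Label.Z k))) (a : Label M D) :
    traceNorm (ρ a - refState ψ a) ≤ errorBound f δp δo a := by
  cases a with
  | psi j => exact h.close_psi hs hD (hf j) (hov j)
  | Z k => exact h.close_Z k
  | X k => exact h.close_X k
  | Y k => exact h.close_Y k
  | XX k => exact h.close_XX hs k
  | YY k => exact h.close_YY k

/-- The composition of the change of basis, the diagonal phases and, if needed, complex conjugation
brings the whole family within the explicit bounds. -/
theorem exists_conj_close {f : Fin M → ℝ} (hD : 3 ≤ D) (h : IsApprox ψ ρ δp δo)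
    (hf : ∀ j, 0 < f j)
    (hov : ∀ j k, 1 / f j < overlap (ψ j) (refState ψ (Label.Z k)))
    (hZ : deltaZ' δp δo < 1 / ((D : ℝ) - 1) ^ 2)
    (hnum : -0.2938 + 0.7970 * deltaY D δp δo + 2.2555 * deltaZ D δp δo
        + 0.5 * deltaXX D δp δo + 7.1049 * δo < 0) :
    ∃ T : Op D → Op D, IsUnitaryOrAntiunitaryConj T ∧
        ∀ a, traceNorm (T (ρ a) - refState ψ a) ≤ errorBound f δp δo a := by
  have hs := h.isSmall hD hZ hnum
  have hD' : (3 : ℝ) ≤ D := by exact_mod_cast hD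
  have hδ : 0 ≤ deltaZ' δp δo := by
    have := hs.δp_nonneg; have := hs.δo_nonneg; unfold deltaZ'; positivity
  have hsmall : (D : ℝ) * ((D - 1) * deltaZ' δp δo) ≤ 9 / 16 := by
    have h1 := hs.sq_mul_deltaZ'_le
    have h2 : deltaX' D δp δo ^ 2 ≤ (1 / 1500) ^ 2 :=
      pow_le_pow_left₀ (deltaX'_nonneg hs) hs.deltaX'_le 2
    nlinarith [mul_nonneg hδ (mul_nonneg (sub_nonneg.2 hD') (show (0 : ℝ) ≤ D - 1 by linarith))]
  obtain ⟨V, hV, hV', hfr⟩ := h.exists_framed hD hZ hsmall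
  obtain ⟨u, hu, hXa⟩ := hfr.exists_xAligned hs hD
  have hU := diagonal_conjTranspose_mul hu
  have hW : (diagonal u * V)ᴴ * (diagonal u * V) = 1 := by
    rw [conjTranspose_mul]
    calc _ = Vᴴ * ((diagonal u)ᴴ * diagonal u) * V := by simp only [Matrix.mul_assoc]
      _ = 1 := by rw [hU, Matrix.mul_one, hV]
  have hconj : ∀ A : Op D, diagonal u * (V * A * Vᴴ) * (diagonal u)ᴴ =
      (diagonal u * V) * A * (diagonal u * V)ᴴ := fun A => by
    rw [conjTranspose_mul]; simp only [Matrix.mul_assoc]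
  simp only [hconj] at hXa
  rcases hXa.aligned_or_cc_aligned hs hD with hA | hA
  · refine ⟨fun A => (diagonal u * V) * A * (diagonal u * V)ᴴ, Or.inl ⟨diagonal u * V, ?_,
      fun _ => rfl⟩, fun a => hA.close hs hD hf hov a⟩
    rw [mem_unitaryGroup_iff', star_eq_conjTranspose, hW]
  · refine ⟨fun A => cc ((diagonal u * V) * A * (diagonal u * V)ᴴ),
      Or.inr ⟨cc (diagonal u * V), ?_, fun A => ?_⟩, fun a => hA.close hs hD hf hov a⟩
    · rw [mem_unitaryGroup_iff', star_eq_conjTranspose, ← cc_conjTranspose, ← cc_mul, hW]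
      ext i j
      simp [cc, one_apply, apply_ite]
    · generalize diagonal u * V = W
      change cc (W * A * Wᴴ) = _
      rw [cc_mul, cc_mul, cc_conjTranspose]

/-! ### Asymptotics of the error bounds -/

/-! The bounds below are expressed in the variable `y ≥ 0` with `y ^ 4 = D ^ 2 δ`, in which
`deltaZ = O(y ^ 2)`, `deltaX` and `deltaY` are `O(y)`, and `deltaXX` and `deltaYY` are `O(√y)`. -/

section asymptotics

variable {δ y : ℝ}

lemma deltaZ_le (hD : 3 ≤ D) (hδ : 0 ≤ δ) (hy : 0 ≤ y) (hy1 : y ≤ 1 / 100)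
    (hyδ : y ^ 4 = (D : ℝ) ^ 2 * δ) :
    9 * δ ≤ y ^ 4 ∧ y ^ 4 ≤ 1 / 10000 * y ^ 2 ∧ deltaZ D δ δ ≤ 2 * y ^ 2 := by
  have hD' : (3 : ℝ) ≤ D := by exact_mod_cast hD
  have h9 : 9 * δ ≤ y ^ 4 := by
    rw [hyδ]; exact mul_le_mul_of_nonneg_right (by nlinarith) hδ
  have hy2 : y ^ 2 ≤ (1 / 100) ^ 2 := pow_le_pow_left₀ hy hy1 2
  have hy4 : y ^ 4 ≤ 1 / 10000 * y ^ 2 := by nlinarith [sq_nonneg y]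
  refine ⟨h9, hy4, ?_⟩
  have ht : δ * ((D : ℝ) - 1) ^ 2 ≤ y ^ 4 := by
    rw [hyδ, mul_comm]; exact mul_le_mul_of_nonneg_right (by nlinarith) hδ
  have : √(1 - (1 - deltaZ' δ δ / 8 * ((D : ℝ) - 1) ^ 2) ^ 2) ≤ 9 / 10 * y ^ 2 := by
    refine Real.sqrt_le_iff.2 ⟨by positivity, ?_⟩
    have e : deltaZ' δ δ / 8 * ((D : ℝ) - 1) ^ 2 = 3 / 8 * (δ * ((D : ℝ) - 1) ^ 2) := by
      unfold deltaZ'; ring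
    rw [e]
    nlinarith [sq_nonneg (3 / 8 * (δ * ((D : ℝ) - 1) ^ 2))]
  unfold deltaZ
  linarith

lemma deltaX_le (hD : 3 ≤ D) (hδ : 0 ≤ δ) (hy : 0 ≤ y) (hy1 : y ≤ 1 / 100)
    (hyδ : y ^ 4 = (D : ℝ) ^ 2 * δ) :
    deltaX' D δ δ ≤ 11 / 10 * y ^ 2 ∧ deltaX D δ δ ≤ 3 * y := by
  obtain ⟨h9, hy4, hZ⟩ := deltaZ_le hD hδ hy hy1 hyδ
  have hX' : deltaX' D δ δ ≤ 11 / 10 * y ^ 2 := by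
    unfold deltaX'; nlinarith [sq_nonneg y]
  refine ⟨hX', ?_⟩
  have h1 : √(deltaX' D δ δ) ≤ 21 / 20 * y :=
    Real.sqrt_le_iff.2 ⟨by positivity, by nlinarith [sq_nonneg y]⟩
  have h2 : √2 ≤ 71 / 50 := Real.sqrt_le_iff.2 ⟨by norm_num, by norm_num⟩
  have h3 : √2 * √(deltaX' D δ δ) ≤ 71 / 50 * (21 / 20 * y) :=
    mul_le_mul h2 h1 (Real.sqrt_nonneg _) (by norm_num)
  unfold deltaX
  nlinarith

lemma deltaY_le (hD : 3 ≤ D) (hδ : 0 ≤ δ) (hy : 0 ≤ y) (hy1 : y ≤ 1 / 100)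
    (hyδ : y ^ 4 = (D : ℝ) ^ 2 * δ) :
    deltaY D δ δ ≤ 6 * y := by
  obtain ⟨h9, hy4, hZ⟩ := deltaZ_le hD hδ hy hy1 hyδ
  obtain ⟨hX', hX⟩ := deltaX_le hD hδ hy hy1 hyδ
  have hZ0 := deltaZ_nonneg D hδ δ
  have hX0 := deltaX_nonneg D hδ δ
  have hyy : y ^ 2 ≤ 1 / 100 * y := by nlinarith
  have hμ : muY D δ δ ≤ 3 * y ^ 2 := by
    have e1 : ((deltaX D δ δ + deltaZ D δ δ) / 2 + 2 * δ + 2 * δ) ^ 2 ≤ (8 / 5 * y) ^ 2 :=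
      pow_le_pow_left₀ (by positivity) (by nlinarith) 2
    have e2 : (deltaZ D δ δ / 2 + δ + δ) ^ 2 ≤ (11 / 10 * y ^ 2) ^ 2 :=
      pow_le_pow_left₀ (by positivity) (by rw [deltaX'] at hX'; exact hX') 2
    unfold muY
    nlinarith [sq_nonneg y]
  have hν : 1 - 11 / 5 * y ^ 2 ≤ nuY D δ δ := by
    rw [deltaX'] at hX'; unfold nuY; linarith
  have hμ0 : 0 ≤ muY D δ δ := by unfold muY; positivity
  have hy2 : y ^ 2 ≤ 1 / 10000 := by nlinarith
  set μ := muY D δ δ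
  set ν := nuY D δ δ
  have hroot : ν - 4 * μ ≤ √(ν ^ 2 - 4 * μ) := Real.le_sqrt_of_sq_le (by nlinarith)
  have hf : √(1 - fRoot μ ν) ≤ 29 / 10 * y :=
    Real.sqrt_le_iff.2 ⟨by positivity, by unfold fRoot; nlinarith⟩
  unfold deltaY
  nlinarith

lemma deltaXX_deltaYY_le (hD : 3 ≤ D) (hδ : 0 ≤ δ) (hy : 0 ≤ y) (hy1 : y ≤ 1 / 100)
    (hyδ : y ^ 4 = (D : ℝ) ^ 2 * δ) :
    deltaXX D δ δ ≤ 4 * √y ∧ deltaYY D δ δ ≤ 8 * √y := by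
  obtain ⟨h9, hy4, hZ⟩ := deltaZ_le hD hδ hy hy1 hyδ
  obtain ⟨hX', hX⟩ := deltaX_le hD hδ hy hy1 hyδ
  have hY := deltaY_le hD hδ hy hy1 hyδ
  have hyy : y ^ 2 ≤ 1 / 100 * y := by nlinarith
  have hs := Real.sq_sqrt hy
  constructor
  · have : √(6 / 5 * deltaX D δ δ + 9 / 10 * deltaZ D δ δ + 21 / 5 * δ) ≤ 2 * √y :=
      Real.sqrt_le_iff.2 ⟨by positivity, by rw [mul_pow, hs]; linarith⟩
    unfold deltaXX; linarith
  · have : √(3 / 2 * deltaZ D δ δ + 2 * deltaY D δ δ + 7 * δ) ≤ 4 * √y :=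
      Real.sqrt_le_iff.2 ⟨by positivity, by rw [mul_pow, hs]; linarith⟩
    unfold deltaYY; linarith

lemma deltaPsi_le (hD : 3 ≤ D) (hδ : 0 ≤ δ) (hy : 0 ≤ y) (hy1 : y ≤ 1 / 100)
    (hyδ : y ^ 4 = (D : ℝ) ^ 2 * δ) {f : ℝ} (hf : (D : ℝ) ≤ f) :
    deltaPsi D (2 * f) δ δ ≤ 8 * √(f * (D : ℝ) ^ 3 * y) := by
  obtain ⟨h9, hy4, hZ⟩ := deltaZ_le hD hδ hy hy1 hyδ
  obtain ⟨hX', hX⟩ := deltaX_le hD hδ hy hy1 hyδ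
  have hY := deltaY_le hD hδ hy hy1 hyδ
  have hZ0 := deltaZ_nonneg D hδ δ
  have hX0 := deltaX_nonneg D hδ δ
  have hY0 := deltaY_nonneg D hδ δ
  have hD' : (3 : ℝ) ≤ D := by exact_mod_cast hD
  have hf0 : 0 < f := by linarith
  have hcos : 2 / (D : ℝ) ^ 2 ≤ 1 - Real.cos (Real.pi / D) := by
    have h := Real.cos_le_one_sub_mul_cos_sq (x := Real.pi / D) (by
      rw [abs_of_nonneg (by positivity)]
      exact div_le_self Real.pi_pos.le (by linarith))
    have e : 2 / Real.pi ^ 2 * (Real.pi / D) ^ 2 = 2 / (D : ℝ) ^ 2 := by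
      field_simp
    linarith
  have hp : 1 - ((D : ℝ) - 1) / (2 * f) ≤ 1 := by
    have : 0 ≤ ((D : ℝ) - 1) / (2 * f) := div_nonneg (by linarith) (by linarith)
    linarith
  have hp0 : 0 < 1 - ((D : ℝ) - 1) / (2 * f) := by
    rw [sub_pos, div_lt_one (by linarith)]; linarith
  have hxi : 2 / (D : ℝ) ^ 2 ≤ xi D (2 * f) := by
    refine hcos.trans ?_
    unfold xi
    refine le_mul_of_one_le_left (le_trans (by positivity) hcos) ?_
    rw [le_div_iff₀ hp0]; linarith
  have hxi0 : 0 < xi D (2 * f) := lt_of_lt_of_le (by positivity) hxi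
  obtain ⟨κ, hκ⟩ : ∃ κ, κ = 2 * f * ((D : ℝ) - 1) / xi D (2 * f) := ⟨_, rfl⟩
  have hκ0 : 0 ≤ κ := by
    rw [hκ]; exact div_nonneg (mul_nonneg (by linarith) (by linarith)) hxi0.le
  set G := f * (D : ℝ) ^ 3 with hG
  have hκG : κ ≤ G := by
    rw [hκ, div_le_iff₀ hxi0]
    have h1 : G * (2 / (D : ℝ) ^ 2) ≤ G * xi D (2 * f) :=
      mul_le_mul_of_nonneg_left hxi (by positivity)
    have h2 : G * (2 / (D : ℝ) ^ 2) = 2 * f * D := by rw [hG]; field_simp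
    nlinarith
  have hDG : (D : ℝ) ≤ G := by
    have h1 : (1 : ℝ) ≤ (D : ℝ) ^ 3 := one_le_pow₀ (by linarith)
    rw [hG]; nlinarith
  have hs2 : √2 ≤ 3 / 2 := Real.sqrt_le_iff.2 ⟨by norm_num, by norm_num⟩
  have hs0 := Real.sqrt_nonneg 2
  have hyy : y ^ 2 ≤ 1 / 100 * y := by nlinarith
  have hrad : (D + ((D : ℝ) - 1) * (1 + √2) * (2 * f) / (2 * xi D (2 * f))) * deltaZ D δ δ
      + (2 * f) * ((D : ℝ) - 1) / (2 * xi D (2 * f)) * deltaX D δ δ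
      + (2 * f) * ((D : ℝ) - 1) / (2 * xi D (2 * f)) * deltaY D δ δ
      + (D + ((D : ℝ) - 1) * (1 + √2) * (2 * f) / xi D (2 * f)
        + 2 * ((2 * f) * ((D : ℝ) - 1) / xi D (2 * f))) * δ =
      (D + (1 + √2) / 2 * κ) * deltaZ D δ δ + κ / 2 * deltaX D δ δ + κ / 2 * deltaY D δ δ
        + (D + (1 + √2) * κ + 2 * κ) * δ := by
    rw [hκ]
    field_simp
  have hG0 : 0 ≤ G := hκ0.trans hκG
  have hsκ : (1 + √2) * κ ≤ 5 / 2 * G :=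
    mul_le_mul (by linarith) hκG hκ0 (by norm_num)
  have b1 : (D + (1 + √2) / 2 * κ) * deltaZ D δ δ ≤ (9 / 4 * G) * (2 * y ^ 2) :=
    mul_le_mul (by linarith) hZ hZ0 (by positivity)
  have b2 : κ / 2 * deltaX D δ δ ≤ G / 2 * (3 * y) :=
    mul_le_mul (by linarith) hX hX0 (by positivity)
  have b3 : κ / 2 * deltaY D δ δ ≤ G / 2 * (6 * y) :=
    mul_le_mul (by linarith) hY hY0 (by positivity)
  have b4 : (D + (1 + √2) * κ + 2 * κ) * δ ≤ (11 / 2 * G) * (1 / 100 * y) :=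
    mul_le_mul (by linarith) (by nlinarith) hδ (by positivity)
  have b5 : G * y ^ 2 ≤ G * (1 / 100 * y) := mul_le_mul_of_nonneg_left hyy hG0
  have hGy : 0 ≤ G * y := mul_nonneg hG0 hy
  rw [deltaPsi, hrad]
  have : √((D + (1 + √2) / 2 * κ) * deltaZ D δ δ + κ / 2 * deltaX D δ δ + κ / 2 * deltaY D δ δ
        + (D + (1 + √2) * κ + 2 * κ) * δ) ≤ 4 * √(G * y) :=
    Real.sqrt_le_iff.2 ⟨by positivity, by rw [mul_pow, Real.sq_sqrt hGy]; linarith⟩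
  linarith

end asymptotics

/-- Once `y` is small, all error bounds are at most `8 √(f D ^ 3 y)`; otherwise the
claimed bound exceeds the diameter `2` of the set of states. -/
theorem exists_wignerPropertyWith : ∃ C : ℝ, 0 < C ∧
      ∀ (D M : ℕ) (ψ : Fin M → Op D) (f : ℝ),
        3 ≤ D →
        1 ≤ M →
        0 < f →
        (∀ j, IsPureState (ψ j)) →
        (∀ j k, 1 / f ≤ overlap (ψ j) (refState ψ (Label.Z k))) →
        WignerPropertyWith (refState ψ)
          (fun δ => C * √f * (D : ℝ) ^ (7 / 4 : ℝ) * δ ^ (1 / 8 : ℝ)) := by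
  refine ⟨8, by norm_num, ?_⟩
  intro D M ψ f hD hM hf hψ hov δ ρ hδ hρ hover
  have hD' : (3 : ℝ) ≤ D := by exact_mod_cast hD
  -- In terms of `y` the error bounds are polynomial: `δ = y ^ 4 / D ^ 2`.
  set y : ℝ := √D * δ ^ (1 / 4 : ℝ) with hy
  have hy0 : 0 ≤ y := by positivity
  have hyδ : y ^ 4 = (D : ℝ) ^ 2 * δ := by
    have e1 : (√(D : ℝ)) ^ 4 = (D : ℝ) ^ 2 := by
      rw [show (√(D : ℝ)) ^ 4 = (√(D : ℝ) ^ 2) ^ 2 by ring, Real.sq_sqrt (by linarith)]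
    have e2 : (δ ^ (1 / 4 : ℝ)) ^ 4 = δ := by
      rw [← Real.rpow_natCast, ← Real.rpow_mul hδ]; norm_num
    rw [hy, mul_pow, e1, e2]
  have hg : 8 * √f * (D : ℝ) ^ (7 / 4 : ℝ) * δ ^ (1 / 8 : ℝ) = 8 * √(f * (D : ℝ) ^ 3 * y) := by
    have e1 : (D : ℝ) ^ 3 * y = ((D : ℝ) ^ (7 / 4 : ℝ) * δ ^ (1 / 8 : ℝ)) ^ 2 := by
      rw [mul_pow, ← Real.rpow_natCast (δ ^ (1 / 8 : ℝ)), ← Real.rpow_mul hδ,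
        ← Real.rpow_natCast ((D : ℝ) ^ (7 / 4 : ℝ)), ← Real.rpow_mul (by linarith), hy,
        Real.sqrt_eq_rpow, ← mul_assoc, ← Real.rpow_natCast (D : ℝ) 3,
        ← Real.rpow_add (by linarith)]
      norm_num
    rw [mul_assoc f, Real.sqrt_mul hf.le, e1, Real.sqrt_sq (by positivity)]
    ring
  simp only [hg]
  have hap : IsApprox ψ ρ δ δ := by
    refine ⟨hψ, hρ, fun a b _ => by rw [abs_sub_comm]; exact hover a b, fun a => ?_⟩
    have := hover a a
    rw [(isPureState_refState hψ a).overlap_self] at this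
    exact (le_abs_self _).trans this
  by_cases hbig : 1 / 4 ≤ √(f * (D : ℝ) ^ 3 * y)
  · refine ⟨id, Or.inl ⟨1, one_mem _, fun A => by simp⟩, fun a => ?_⟩
    have := traceNorm_sub_le_two (hap.ref a) (hρ a)
    simp only [id]
    linarith
  -- The `D` weights of a normalized vector cannot all exceed `1 / D`.
  have hfD : (D : ℝ) ≤ f := by
    obtain ⟨c, hc, hψc⟩ := hψ ⟨0, hM⟩
    have h1 := Finset.card_nsmul_le_sum Finset.univ (fun i => ‖c i‖ ^ 2) (1 / f) (fun i _ => by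
      have := hov ⟨0, hM⟩ i
      rwa [hψc, refState_Z, overlap_single, proj_apply, RCLike.star_def, Complex.mul_conj',
        ← Complex.ofReal_pow, Complex.ofReal_re] at this)
    rw [Finset.card_univ, Fintype.card_fin, nsmul_eq_mul, hc, mul_one_div, div_le_one hf] at h1
    exact h1
  have hG : 81 ≤ f * (D : ℝ) ^ 3 := by
    have h1 : (3 : ℝ) ^ 3 ≤ (D : ℝ) ^ 3 := pow_le_pow_left₀ (by norm_num) hD' 3
    nlinarith
  have hy1 : y ≤ 1 / 100 := by
    rw [not_le, Real.sqrt_lt' (by norm_num)] at hbig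
    nlinarith
  obtain ⟨h9, hy4, hZ⟩ := deltaZ_le hD hδ hy0 hy1 hyδ
  obtain ⟨hX', hX⟩ := deltaX_le hD hδ hy0 hy1 hyδ
  have hY := deltaY_le hD hδ hy0 hy1 hyδ
  obtain ⟨hXX, hYY⟩ := deltaXX_deltaYY_le hD hδ hy0 hy1 hyδ
  have hyy : y ^ 2 ≤ 1 / 100 * y := by nlinarith
  have hsy : √y ≤ 1 / 10 := Real.sqrt_le_iff.2 ⟨by norm_num, by linarith⟩
  obtain ⟨T, hT, hclose⟩ := exists_conj_close (f := fun _ => 2 * f) hD hap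
    (fun _ => by linarith)
    (fun j k => lt_of_lt_of_le (one_div_lt_one_div_of_lt hf (by linarith)) (hov j k))
    (by
      rw [lt_div_iff₀ (by nlinarith)]
      have : δ * ((D : ℝ) - 1) ^ 2 ≤ y ^ 4 := by
        rw [hyδ, mul_comm]; exact mul_le_mul_of_nonneg_right (by nlinarith) hδ
      unfold deltaZ'
      nlinarith)
    (by norm_num; linarith)
  refine ⟨T, hT, fun a => ?_⟩
  rw [traceNorm_sub_comm]
  refine (hclose a).trans ?_
  have hys : √y ≤ √(f * (D : ℝ) ^ 3 * y) := Real.sqrt_le_sqrt (by nlinarith)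
  have hyr : y ≤ √y := Real.le_sqrt_of_sq_le (by linarith)
  cases a with
  | psi j => exact deltaPsi_le hD hδ hy0 hy1 hyδ hfD
  | Z k => simp only [errorBound]; linarith
  | X k => simp only [errorBound]; linarith
  | Y k => simp only [errorBound]; linarith
  | XX k => simp only [errorBound]; linarith
  | YY k => simp only [errorBound]; linarith

end RobustWigner

theorem mainTheorem3 :
    (∀ (D M : ℕ) (ψ : Fin M → Op D) (f : Fin M → ℝ) (ρ : Label M D → Op D) (δp δo : ℝ),
      3 ≤ D →
      (∀ j, IsPureState (ψ j)) →
      (∀ j, 0 < f j) →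
      (∀ j k, 1 / f j < overlap (ψ j) (refState ψ (Label.Z k))) →
      (∀ a, IsState (ρ a)) →
      (∀ a b, refState ψ a ≠ refState ψ b →
        |overlap (ρ a) (ρ b) - overlap (refState ψ a) (refState ψ b)| ≤ δo) →
      (∀ a, 1 - overlap (ρ a) (ρ a) ≤ δp) →
      deltaZ' δp δo < 1 / ((D : ℝ) - 1) ^ 2 →
      0 ≤ nuY D δp δo ^ 2 - 4 * muY D δp δo →
      -0.2938 + 0.7970 * deltaY D δp δo + 2.2555 * deltaZ D δp δo
        + 0.5 * deltaXX D δp δo + 7.1049 * δo < 0 →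
      ∃ T : Op D → Op D, IsUnitaryOrAntiunitaryConj T ∧
        ∀ a, traceNorm (T (ρ a) - refState ψ a) ≤ errorBound f δp δo a) ∧
    (∃ C : ℝ, 0 < C ∧
      ∀ (D M : ℕ) (ψ : Fin M → Op D) (f : ℝ),
        3 ≤ D →
        1 ≤ M →
        0 < f →
        (∀ j, IsPureState (ψ j)) →
        (∀ j k, 1 / f ≤ overlap (ψ j) (refState ψ (Label.Z k))) →
        WignerPropertyWith (refState ψ)
          (fun δ => C * √f * (D : ℝ) ^ (7 / 4 : ℝ) * δ ^ (1 / 8 : ℝ))) := by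
  refine ⟨?_, exists_wignerPropertyWith⟩
  intro D M ψ f ρ δp δo hD hψ hf hov hρ hover hpur hZ _ hnum
  exact exists_conj_close hD ⟨hψ, hρ, hover, hpur⟩ hf hov hZ hnum
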